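/- **Theorem.** Let $n\ge 0$ and let $\Omega\subset\mathbb{RP}^n$ be a convex projective domain, i.e. a nonempty open set contained in some affine chart and convex there. Suppose that $\Omega$ is strictly convex, i.e. its boundary $\partial\Omega$ in $\mathbb{RP}^n$ contains no (nondegenerate projective) line segment; if $n=1$, suppose in addition that $\Omega$ is properly convex, i.e. there is no non-constant projective map $\mathbb R\to\Omega$ (for $n=1$ this only excludes $\mathbb{RP}^1$ minus a point). Suppose that $\Omega$ is quasi-homogeneous: there are a compact set $K\subset\Omega$ and a subgroup $G$ of $\mathrm{Aut}(\Omega)=\{g\in\mathrm{PGL}(n+1,\mathbb R): g\Omega=\Omega\}$ with $GK=\Omega$. Say that $\partial\Omega$ is *twice differentiable near* $p\in\partial\Omega$ if, in some affine chart with a suitable choice of affine coordinates $x_1,\dots,x_n$, the set $\partial\Omega$ is given on some open neighbourhood of $p$ by an equation expressing one coordinate as a function $f$ of the other $n-1$ coordinates, where $f$ is twice (Fréchet) differentiable at every point of an open subset of $\mathbb R^{n-1}$ (the second derivative need not be continuous). 1. If $\partial\Omega$ is twice differentiable near each of its points, then $\Omega$ is projectively equivalent to a ball: there is a projective transformation $g\in\mathrm{PGL}(n+1,\mathbb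 R)$ with $\Omega=g(B)$, where $B$ is the open unit ball of the standard affine chart $\mathbb R^n\subset\mathbb{RP}^n$. 2. More generally, if there is an open set $O\subset\mathbb{RP}^n$ with $O\cap\partial\Omega\neq\emptyset$ such that $\partial\Omega$ is twice differentiable near every point of $O\cap\partial\Omega$, then $\Omega$ is projectively equivalent to a ball. -/

import Mathlib

open scoped LinearAlgebra.Projectivization Pointwise

noncomputable section

namespace QuasiHom

/-- The real projective space `RP^n`, i.e. nonzero vectors of `ℝ^(n+1)` modulo scalars. -/
abbrev RP (n : ℕ) : Type := ℙ ℝ (Fin (n + 1) → ℝ)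

/-- The quotient topology coming from `ℝ^(n+1) \ {0}`. -/
instance instTopologicalSpaceRP (n : ℕ) : TopologicalSpace (RP n) :=
  TopologicalSpace.coinduced
    (fun v : {v : Fin (n + 1) → ℝ // v ≠ 0} => Projectivization.mk ℝ v.1 v.2) inferInstance

/-- `GL(n+1, ℝ)`. It acts on `RP^n` through its quotient `PGL(n+1, ℝ)` by the scalars, so the
maps `p ↦ g • p` are exactly the projective transformations of `RP^n`. -/
abbrev GLin (n : ℕ) : Type := LinearMap.GeneralLinearGroup ℝ (Fin (n + 1) → ℝ)

theorem cons_one_ne_zero {n : ℕ} (x : EuclideanSpace ℝ (Fin n)) :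
    (Fin.cons 1 (fun j => x j) : Fin (n + 1) → ℝ) ≠ 0 := by
  intro h
  have h0 := congrFun h 0
  simp at h0

/-- The standard affine chart `ℝ^n → RP^n`, `x ↦ [1 : x_1 : … : x_n]`. An arbitrary affine chart
(with an arbitrary affine basis) is `x ↦ g • affineChart x` for some `g ∈ GL(n+1, ℝ)`. -/
def affineChart {n : ℕ} (x : EuclideanSpace ℝ (Fin n)) : RP n :=
  Projectivization.mk ℝ (Fin.cons 1 (fun j => x j)) (cons_one_ne_zero x)

/-- The set `π⁻¹(B)` of nonzero vectors of `ℝ^(n+1)` representing a point of `B ⊆ RP^n`. -/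
def lift {n : ℕ} (B : Set (RP n)) : Set (Fin (n + 1) → ℝ) :=
  {v | ∃ hv : v ≠ 0, Projectivization.mk ℝ v hv ∈ B}

/-- A convex projective domain: a nonempty open subset of `RP^n` which is contained in some affine
chart and is convex there. -/
structure IsConvexDomain {n : ℕ} (Ω : Set (RP n)) : Prop where
  isOpen : IsOpen Ω
  nonempty : Ω.Nonempty
  convex : ∃ (g : GLin n) (C : Set (EuclideanSpace ℝ (Fin n))),
    Convex ℝ C ∧ Ω = g • (affineChart '' C)

/-- A convex domain is properly convex if there is no non-constant projective map of `ℝ` into it.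
Such a map is `t ↦ [a + t b]` with `a, b` linearly independent. -/
def IsProperlyConvex {n : ℕ} (Ω : Set (RP n)) : Prop :=
  IsConvexDomain Ω ∧
    ¬ ∃ a b : Fin (n + 1) → ℝ, LinearIndependent ℝ ![a, b] ∧ ∀ t : ℝ, a + t • b ∈ lift Ω

/-- A convex domain is strictly convex if its boundary in `RP^n` contains no line segment.
A segment is the image of `[a, b] ⊆ ℝ^(n+1)` with `a, b` linearly independent. -/
def IsStrictlyConvex {n : ℕ} (Ω : Set (RP n)) : Prop :=
  IsConvexDomain Ω ∧
    ¬ ∃ a b : Fin (n + 1) → ℝ, LinearIndependent ℝ ![a, b] ∧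
      ∀ v ∈ segment ℝ a b, v ∈ lift (frontier Ω)

/-- `Ω` is quasi-homogeneous: some group `G` of projective transformations preserving `Ω`
and some compact `K ⊆ Ω` satisfy `G K = Ω`. -/
def IsQuasiHomogeneous {n : ℕ} (Ω : Set (RP n)) : Prop :=
  ∃ G : Subgroup (GLin n), G ≤ MulAction.stabilizer (GLin n) Ω ∧
    ∃ K : Set (RP n), IsCompact K ∧ K ⊆ Ω ∧ (⋃ g ∈ G, g • K) = Ω

/-- `f` is twice (Fréchet) differentiable on the open set `U`; the second derivative is not assumed
to be continuous. -/
def TwiceDifferentiableOn {E : Type*} [NormedAddCommGroup E] [NormedSpace ℝ E]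
    (f : E → ℝ) (U : Set E) : Prop :=
  DifferentiableOn ℝ f U ∧ DifferentiableOn ℝ (fderiv ℝ f) U

/-- Forget the `i`-th coordinate. -/
def dropCoord {n : ℕ} (i : Fin n) (x : EuclideanSpace ℝ (Fin n)) :
    EuclideanSpace ℝ {j : Fin n // j ≠ i} :=
  WithLp.toLp 2 fun j => x j.1

/-- Near `p`, the boundary of `Ω` is the graph of a twice differentiable function: in some affine
chart and on some open neighbourhood `W` of `p` it has the equation
`x_i = f (x_1, …, x_{i-1}, x_{i+1}, …, x_n)`, with `f` twice differentiable. -/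
def BoundaryTwiceDifferentiableNear {n : ℕ} (Ω : Set (RP n)) (p : RP n) : Prop :=
  ∃ (g : GLin n) (i : Fin n) (W : Set (EuclideanSpace ℝ (Fin n)))
    (U : Set (EuclideanSpace ℝ {j : Fin n // j ≠ i}))
    (f : EuclideanSpace ℝ {j : Fin n // j ≠ i} → ℝ),
    IsOpen W ∧ IsOpen U ∧ TwiceDifferentiableOn f U ∧
    (∃ x ∈ W, g • affineChart x = p) ∧
    ∀ x ∈ W, dropCoord i x ∈ U ∧ (g • affineChart x ∈ frontier Ω ↔ x i = f (dropCoord i x))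

/-- `Ω` is projectively equivalent to a ball (equivalently, it is an ellipsoid). -/
def IsProjectivelyEquivalentToBall {n : ℕ} (Ω : Set (RP n)) : Prop :=
  ∃ g : GLin n, Ω = g • (affineChart '' Metric.ball (0 : EuclideanSpace ℝ (Fin n)) 1)

end QuasiHom

end

/-! Lift `Ω` to an open convex cone `K` in `ℝ^(n+1)` whose union with `-K` is `lift Ω`. Strict
convexity (proper convexity when `n = 1`) makes `K` salient. Near a boundary point, in suitable
linear coordinates, `K` is the cone over the part above a graph of some `f`. Then `f` is convex, and
it lies strictly above its tangents because the frontier contains no segment.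

The crux is a point where the Hessian of `f` is nondegenerate. Minimising `f - p` for linear forms
`p` close to a given differential shows that the differentials of `f` fill a ball
(`exists_ball_subset_image_fderiv`). If the Hessian were singular everywhere, the set of
differentials would be null by the equidimensional Sard lemma, which needs differentiability only
(`exists_injective_fderiv_fderiv`). So the Hessian `q` is positive definite somewhere, with no
continuity of second derivatives.

Zooming in there by `h⁻¹` tangentially and `h⁻²` transversally, the images of `K` converge to the
cone `q y y < 2 * a * s` over a paraboloid, which is linearly a cone over a ball. A salient
quasi-homogeneous cone is equivalent to every salient limit of its linear images
(`exists_linearEquiv_of_limit`): corrected by automorphisms, the maps send a base point into a fixed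
compact set, hence stay bounded, and a limit of them is an isomorphism.

One boundary point suffices, so both assertions follow from the same statement; `RP 0` is a single
point. -/

namespace QuasiHom

open Filter Topology

/-! ### Open convex cones and salience. -/

/-- A nonempty open convex cone not containing the origin. -/
structure IsOpenConvexCone {V : Type*} [NormedAddCommGroup V] [NormedSpace ℝ V] (K : Set V) :
    Prop where
  isOpen : IsOpen K
  nonempty : K.Nonempty
  add_mem : ∀ {x y}, x ∈ K → y ∈ K → x + y ∈ K
  smul_mem : ∀ {c : ℝ} {x}, 0 < c → x ∈ K → c • x ∈ K
  zero_notMem : (0 : V) ∉ K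

/-- A set whose closure contains no line through the origin. -/
def IsSalient {V : Type*} [NormedAddCommGroup V] (K : Set V) : Prop :=
  ∀ v, v ∈ closure K → -v ∈ closure K → v = 0

namespace IsOpenConvexCone

variable {V : Type*} [NormedAddCommGroup V] [NormedSpace ℝ V] {K : Set V}

theorem convex (hK : IsOpenConvexCone K) : Convex ℝ K := by
  rw [convex_iff_forall_pos]
  intro x hx y hy a b ha hb _
  exact hK.add_mem (hK.smul_mem ha hx) (hK.smul_mem hb hy)

/-- Write `x + y = (x + y - y') + y'` with `y' ∈ K` so close to `y` that the first summand is still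
in the open set `K`. -/
theorem add_mem_of_mem_closure (hK : IsOpenConvexCone K) {x y : V} (hx : x ∈ K)
    (hy : y ∈ closure K) : x + y ∈ K := by
  have h : ∀ᶠ y' in 𝓝 y, x + y - y' ∈ K := by
    have : Tendsto (fun y' => x + y - y') (𝓝 y) (𝓝 (x + y - y)) :=
      (continuous_const.sub continuous_id).tendsto y
    rw [add_sub_cancel_right] at this
    exact this.eventually (hK.isOpen.mem_nhds hx)
  obtain ⟨y', h1, h2⟩ := (h.and_frequently (mem_closure_iff_frequently.1 hy)).exists
  simpa using hK.add_mem h1 h2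

theorem neg_notMem_closure (hK : IsOpenConvexCone K) {x : V} (hx : x ∈ K) : -x ∉ closure K :=
  fun h => hK.zero_notMem (by simpa using hK.add_mem_of_mem_closure hx h)

theorem smul_mem_closure (hK : IsOpenConvexCone K) {c : ℝ} {x : V} (hc : 0 < c)
    (hx : x ∈ closure K) : c • x ∈ closure K :=
  map_mem_closure (continuous_const_smul c) hx fun _ h => hK.smul_mem hc h

theorem smul_mem_iff (hK : IsOpenConvexCone K) {c : ℝ} {x : V} (hc : 0 < c) :
    c • x ∈ K ↔ x ∈ K := by
  refine ⟨fun h => ?_, hK.smul_mem hc⟩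
  simpa [smul_smul, hc.ne'] using hK.smul_mem (inv_pos.2 hc) h

/-- Limits only give membership in closures; this recovers the open cone itself. -/
theorem interior_closure_eq (hK : IsOpenConvexCone K) : interior (closure K) = K := by
  rw [hK.convex.interior_closure_eq_interior_of_nonempty_interior
    (by rw [hK.isOpen.interior_eq]; exact hK.nonempty), hK.isOpen.interior_eq]

theorem frontier_eq (hK : IsOpenConvexCone K) : frontier K = closure K \ K := by
  rw [frontier, hK.isOpen.interior_eq]

theorem preimage {V' : Type*} [NormedAddCommGroup V'] [NormedSpace ℝ V'] [FiniteDimensional ℝ V']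
    (hK : IsOpenConvexCone K) (e : V' ≃ₗ[ℝ] V) : IsOpenConvexCone (e ⁻¹' K) where
  isOpen := hK.isOpen.preimage e.toLinearMap.continuous_of_finiteDimensional
  nonempty := hK.nonempty.preimage e.surjective
  add_mem hx hy := by simpa using hK.add_mem hx hy
  smul_mem hc hx := by simpa using hK.smul_mem hc hx
  zero_notMem := by simpa using hK.zero_notMem

end IsOpenConvexCone

/-- A connected set that meets an open set but not its frontier is contained in it. -/
theorem subset_of_disjoint_frontier {X : Type*} [TopologicalSpace X] {P D : Set X}
    (hP : IsPreconnected P) (hD : IsOpen D) (hPD : (P ∩ D).Nonempty)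
    (h : ∀ x ∈ P, x ∉ frontier D) : P ⊆ D := by
  refine hP.subset_left_of_subset_union hD isClosed_closure.isOpen_compl
    (disjoint_compl_right.mono_left subset_closure |>.mono_right le_rfl) (fun x hx => ?_) hPD
  by_cases hxc : x ∈ closure D
  · left
    by_contra hxD
    exact h x hx (by rw [frontier, hD.interior_eq]; exact ⟨hxc, hxD⟩)
  · exact Or.inr hxc

/-! ### The cone over a ball. -/

/-- The cone over the open unit ball. -/
def ballCone (F : Type*) [NormedAddCommGroup F] : Set (ℝ × F) := {z | ‖z.2‖ < z.1}

section BallCone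

variable {F : Type*} [NormedAddCommGroup F]

theorem isOpenConvexCone_ballCone [NormedSpace ℝ F] : IsOpenConvexCone (ballCone F) where
  isOpen := isOpen_lt (by fun_prop) (by fun_prop)
  nonempty := ⟨(1, 0), by simp [ballCone]⟩
  add_mem {x y} hx hy := (norm_add_le _ _).trans_lt (add_lt_add hx hy)
  smul_mem {c x} hc hx := by
    simp only [ballCone, Set.mem_ofPred_eq, Prod.smul_snd, Prod.smul_fst, norm_smul, smul_eq_mul,
      Real.norm_eq_abs, abs_of_pos hc] at hx ⊢
    exact mul_lt_mul_of_pos_left hx hc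
  zero_notMem := by simp [ballCone]

theorem mem_closure_ballCone {z : ℝ × F} : z ∈ closure (ballCone F) ↔ ‖z.2‖ ≤ z.1 := by
  constructor
  · intro h
    have hc : IsClosed {z : ℝ × F | ‖z.2‖ ≤ z.1} := isClosed_le (by fun_prop) (by fun_prop)
    have hsub : ballCone F ⊆ {z : ℝ × F | ‖z.2‖ ≤ z.1} := fun w hw => le_of_lt (show ‖w.2‖ < w.1 from hw)
    exact closure_minimal hsub hc h
  · intro h
    have ht : Tendsto (fun ε : ℝ => (z.1 + ε, z.2)) (𝓝[>] 0) (𝓝 z) := by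
      have : Continuous fun ε : ℝ => (z.1 + ε, z.2) := by fun_prop
      simpa using (this.tendsto 0).mono_left nhdsWithin_le_nhds
    refine mem_closure_of_tendsto ht ?_
    filter_upwards [self_mem_nhdsWithin] with ε hε
    simp only [ballCone, Set.mem_ofPred_eq]
    have : (0 : ℝ) < ε := hε
    linarith

theorem isSalient_ballCone : IsSalient (ballCone F) := by
  intro v h1 h2
  rw [mem_closure_ballCone] at h1 h2
  simp only [Prod.snd_neg, norm_neg, Prod.fst_neg] at h2
  have h0 := norm_nonneg v.2
  have h3 : v.1 = 0 := by linarith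
  have h4 : v.2 = 0 := norm_le_zero_iff.1 (by linarith)
  exact Prod.ext h3 h4

end BallCone

/-! ### Limits of linear images of a quasi-homogeneous cone. -/

/-- In a salient cone, symmetric segments with midpoint in a compact subset are bounded. -/
theorem exists_bound_of_isSalient {V : Type*} [NormedAddCommGroup V] [NormedSpace ℝ V]
    [FiniteDimensional ℝ V] {K K₀ : Set V} (hK : IsOpenConvexCone K) (hs : IsSalient K)
    (hK₀ : IsCompact K₀) :
    ∃ R : ℝ, ∀ k ∈ K₀, ∀ x, k + x ∈ K → k - x ∈ K → ‖x‖ ≤ R := by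
  -- Longer and longer offending `x`, normalised, accumulate at a unit vector `u`; the centres are
  -- bounded and disappear after rescaling, so both `u` and `-u` lie in the closure.
  by_contra! hcon
  choose k hk x hx1 hx2 hx using fun m : ℕ => hcon (m + 1 : ℝ)
  have hpos : ∀ m, 0 < ‖x m‖ := fun m => lt_of_le_of_lt (by positivity) (hx m)
  have hmem : ∀ m, ‖x m‖⁻¹ • x m ∈ Metric.sphere (0 : V) 1 := fun m => by
    simp [norm_smul, (hpos m).ne']
  obtain ⟨u, hu, φ, hφ, hlim⟩ := (isCompact_sphere (0 : V) 1).tendsto_subseq hmem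
  have hinv : Tendsto (fun m => ‖x m‖⁻¹) atTop (𝓝 0) := by
    refine tendsto_inv_atTop_zero.comp (tendsto_atTop_mono (fun m => ?_)
      tendsto_natCast_atTop_atTop)
    linarith [hx m]
  obtain ⟨C, hC⟩ := hK₀.isBounded.exists_norm_le
  have hk0 : Tendsto (fun m => ‖x (φ m)‖⁻¹ • k (φ m)) atTop (𝓝 0) := by
    rw [tendsto_zero_iff_norm_tendsto_zero]
    refine squeeze_zero (g := fun m => ‖x (φ m)‖⁻¹ * C) (fun _ => norm_nonneg _) (fun m => ?_) ?_
    · rw [norm_smul, norm_inv, norm_norm]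
      exact mul_le_mul_of_nonneg_left (hC _ (hk _)) (by positivity)
    · simpa using (hinv.comp hφ.tendsto_atTop).mul_const C
  have h1 : u ∈ closure K := by
    refine mem_closure_of_tendsto (b := atTop) (by simpa using hk0.add hlim) ?_
    refine Eventually.of_forall fun m => ?_
    have := hK.smul_mem (inv_pos.2 (hpos (φ m))) (hx1 (φ m))
    simpa [smul_add] using this
  have h2 : -u ∈ closure K := by
    refine mem_closure_of_tendsto (b := atTop) (by simpa using hk0.sub hlim) ?_
    refine Eventually.of_forall fun m => ?_
    have := hK.smul_mem (inv_pos.2 (hpos (φ m))) (hx2 (φ m))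
    simpa [smul_sub] using this
  have := hs u h1 h2
  simp [this] at hu

/-- If linear images of a quasi-homogeneous cone `K` converge to a cone `L`, then `K` is linearly
equivalent to `L`. -/
theorem exists_linearEquiv_of_limit {V V' : Type*} [NormedAddCommGroup V] [NormedSpace ℝ V]
    [FiniteDimensional ℝ V] [NormedAddCommGroup V'] [NormedSpace ℝ V'] [FiniteDimensional ℝ V']
    {K K₀ : Set V} {L : Set V'}
    (hK : IsOpenConvexCone K) (hKs : IsSalient K) (hL : IsOpenConvexCone L) (hLs : IsSalient L)
    (hK₀ : IsCompact K₀) (hK₀K : K₀ ⊆ K)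
    (hqh : ∀ x ∈ K, ∃ γ : V ≃ₗ[ℝ] V, (∀ v, γ v ∈ K ↔ v ∈ K) ∧ ∃ k ∈ K₀, γ k = x)
    (B : ℕ → V' ≃ₗ[ℝ] V) (h₁ : ∀ z ∈ L, ∀ᶠ j in atTop, B j z ∈ K)
    (h₂ : ∀ z, (∃ᶠ j in atTop, B j z ∈ K) → z ∈ closure L) :
    ∃ S : V' ≃ₗ[ℝ] V, ∀ z, S z ∈ K ↔ z ∈ L := by
  obtain ⟨o, ho⟩ := hL.nonempty
  -- Correct `B j` by an automorphism of `K` moving the image of the base point `o` into `K₀`. The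
  -- indices with `B j o ∉ K` are finitely many by `h₁`, and there any choice will do.
  have hex : ∀ j, ∃ S : V' →L[ℝ] V, (∀ z, S z ∈ K ↔ B j z ∈ K) ∧ (B j o ∈ K → S o ∈ K₀) := by
    intro j
    by_cases hj : B j o ∈ K
    · obtain ⟨γ, hγ, k, hk, hkx⟩ := hqh _ hj
      refine ⟨((B j).trans γ.symm).toLinearMap.toContinuousLinearMap, fun z => ?_, fun _ => ?_⟩
      · rw [← hγ]; simp
      · have : γ.symm (B j o) = k := by rw [← hkx]; simp
        simpa [this] using hk
    · exact ⟨(B j).toLinearMap.toContinuousLinearMap, fun z => by simp, fun h => absurd h hj⟩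
  choose S hSK hSo using hex
  obtain ⟨R, hR⟩ := exists_bound_of_isSalient hK hKs hK₀
  -- For small `ε` both `o ± ε • v` lie in `L`, so their images are the ends of a symmetric segment
  -- in `K` centred in `K₀`.
  have hbd : ∀ v : V', ∃ C : ℝ, ∀ᶠ j in atTop, ‖S j v‖ ≤ C := by
    intro v
    have hc : Continuous fun ε : ℝ => o + ε • v := by fun_prop
    have hc' : Continuous fun ε : ℝ => o - ε • v := by fun_prop
    have e1 : ∀ᶠ ε in 𝓝[>] (0 : ℝ), o + ε • v ∈ L :=
      ((hc.tendsto' 0 o (by simp)).mono_left nhdsWithin_le_nhds).eventually (hL.isOpen.mem_nhds ho)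
    have e2 : ∀ᶠ ε in 𝓝[>] (0 : ℝ), o - ε • v ∈ L :=
      ((hc'.tendsto' 0 o (by simp)).mono_left nhdsWithin_le_nhds).eventually
        (hL.isOpen.mem_nhds ho)
    obtain ⟨ε, ⟨hε1, hε2⟩, hε⟩ := ((e1.and e2).and self_mem_nhdsWithin).exists
    have hε : 0 < ε := hε
    refine ⟨R / ε, ?_⟩
    filter_upwards [h₁ _ hε1, h₁ _ hε2, h₁ _ ho] with j hj1 hj2 hj3
    have := hR (S j o) (hSo j hj3) (ε • S j v) (by simpa using (hSK j (o + ε • v)).2 hj1)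
      (by simpa using (hSK j (o - ε • v)).2 hj2)
    rw [norm_smul, Real.norm_eq_abs, abs_of_pos hε] at this
    rw [le_div_iff₀ hε]
    linarith
  let b := Module.finBasis ℝ V'
  choose C hC using fun i => hbd (b i)
  obtain ⟨A, hA0, hA⟩ := b.exists_opNorm_le (F := V)
  have hM : ∀ᶠ j in atTop, ‖S j‖ ≤ A * ∑ i, |C i| := by
    filter_upwards [eventually_all.2 hC] with j hj
    refine hA (Finset.sum_nonneg fun i _ => abs_nonneg _) fun i => ?_
    exact (hj i).trans ((le_abs_self _).trans
      (Finset.single_le_sum (f := fun i => |C i|) (fun i _ => abs_nonneg _) (Finset.mem_univ i)))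
  have hfr : ∃ᶠ j in atTop, S j ∈ Metric.closedBall (0 : V' →L[ℝ] V) (A * ∑ i, |C i|) :=
    (hM.mono fun j hj => by simpa using hj).frequently
  obtain ⟨T, -, φ, hφ, hT⟩ :=
    (isCompact_closedBall (0 : V' →L[ℝ] V) (A * ∑ i, |C i|)).tendsto_subseq' hfr
  have hTz : ∀ z, Tendsto (fun j => S (φ j) z) atTop (𝓝 (T z)) := fun z =>
    ((ContinuousLinearMap.apply ℝ V z).continuous.tendsto T).comp hT
  have hTo : T o ∈ K := hK₀K <| hK₀.isClosed.mem_of_tendsto (hTz o) <| by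
    filter_upwards [hφ.tendsto_atTop.eventually (h₁ o ho)] with j hj using hSo _ hj
  have hTL : ∀ z ∈ L, T z ∈ closure K := fun z hz => mem_closure_of_tendsto (hTz z) <| by
    filter_upwards [hφ.tendsto_atTop.eventually (h₁ z hz)] with j hj using (hSK _ z).2 hj
  have hTK : ∀ z, T z ∈ K → z ∈ closure L := by
    intro z hz
    refine h₂ z (hφ.tendsto_atTop.frequently (Eventually.frequently ?_))
    filter_upwards [(hTz z).eventually (hK.isOpen.mem_nhds hz)] with j hj using (hSK _ z).1 hj
  -- A kernel vector `v` would put the whole line `o + t • v` into the closure of `L`, against the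
  -- salience of `L`.
  have hinj : Function.Injective T := by
    rw [injective_iff_map_eq_zero]
    intro v hv
    have hline : ∀ t : ℝ, o + t • v ∈ closure L := fun t => hTK _ (by simpa [hv] using hTo)
    have hdir : ∀ w : V', (∀ t : ℝ, 0 < t → o + t • w ∈ closure L) → w ∈ closure L := by
      intro w hw
      have ht : Tendsto (fun t : ℝ => t • o + w) (𝓝[>] 0) (𝓝 w) := by
        have : Continuous fun t : ℝ => t • o + w := by fun_prop
        exact (this.tendsto' 0 w (by simp)).mono_left nhdsWithin_le_nhds
      refine isClosed_closure.mem_of_tendsto ht ?_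
      filter_upwards [self_mem_nhdsWithin] with t (ht : 0 < t)
      have := hL.smul_mem_closure ht (hw t⁻¹ (inv_pos.2 ht))
      simpa [smul_smul, ht.ne'] using this
    exact hLs v (hdir v fun t _ => hline t)
      (hdir (-v) fun t _ => by simpa using hline (-t))
  have hfin : Module.finrank ℝ V' = Module.finrank ℝ V := (B 0).finrank_eq
  let e : V' ≃ₗ[ℝ] V := T.toLinearMap.linearEquivOfInjective hinj hfin
  have he : ∀ z, e z = T z := fun z => rfl
  have hce : Continuous e := e.toLinearMap.continuous_of_finiteDimensional
  have hcs : Continuous e.symm := e.symm.toLinearMap.continuous_of_finiteDimensional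
  refine ⟨e, fun z => ⟨fun hz => ?_, fun hz => ?_⟩⟩
  · rw [← hL.interior_closure_eq]
    exact mem_interior.2 ⟨e ⁻¹' K, fun w hw => hTK w hw, hK.isOpen.preimage hce, hz⟩
  · rw [← hK.interior_closure_eq]
    refine mem_interior.2 ⟨e.symm ⁻¹' L, fun w hw => ?_, hL.isOpen.preimage hcs, by simpa using hz⟩
    have := hTL _ hw
    rwa [← he, e.apply_symm_apply] at this

/-! ### Convex sets whose frontier is a graph. -/

section Graph

variable {E : Type*} [NormedAddCommGroup E] [NormedSpace ℝ E]

/-- A convex open set whose frontier is a graph inside a box, and which has a point of the box above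
the graph, is the part of the box above the graph. -/
theorem mem_iff_lt_of_frontier_graph {D : Set (E × ℝ)} (hD : IsOpen D) (hDc : Convex ℝ D)
    {f : E → ℝ} {y₀ : E} {s₀ r δ : ℝ} (hδ : 0 < δ)
    (hf : ∀ y ∈ Metric.ball y₀ r, |f y - s₀| < δ / 2)
    (hfr : ∀ y ∈ Metric.ball y₀ r, ∀ s, |s - s₀| < δ → ((y, s) ∈ frontier D ↔ s = f y))
    (hne : ∃ y ∈ Metric.ball y₀ r, ∃ s, |s - s₀| < δ ∧ f y < s ∧ (y, s) ∈ D) :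
    ∀ y ∈ Metric.ball y₀ r, ∀ s, |s - s₀| < δ → ((y, s) ∈ D ↔ f y < s) := by
  -- Within the box, the open vertical segment above the graph misses the frontier, so one point of
  -- `D` on it brings the whole segment.
  have hvert : ∀ y ∈ Metric.ball y₀ r, (∃ s, |s - s₀| < δ ∧ f y < s ∧ (y, s) ∈ D) →
      ∀ s, |s - s₀| < δ → f y < s → (y, s) ∈ D := by
    rintro y hy ⟨s₁, h1, h2, h3⟩ s h4 h5
    have hpre : IsPreconnected ((fun s : ℝ => (y, s)) '' Set.Ioo (f y) (s₀ + δ)) :=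
      isPreconnected_Ioo.image _ (by fun_prop)
    have hb := abs_lt.1 (hf y hy)
    refine subset_of_disjoint_frontier hpre hD
      ⟨(y, s₁), ⟨s₁, ⟨h2, by linarith [(abs_lt.1 h1).2]⟩, rfl⟩, h3⟩ ?_
      ⟨s, ⟨h5, by linarith [(abs_lt.1 h4).2]⟩, rfl⟩
    rintro _ ⟨t, ⟨ht1, ht2⟩, rfl⟩ hfront
    have := (hfr y hy t (abs_lt.2 ⟨by linarith, by linarith⟩)).1 hfront
    exact ht1.ne' this
  -- The horizontal slice at height `s₀ + δ / 2` is above the graph and inside the box, so it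
  -- carries membership in `D` from one vertical line to all others.
  have htop : ∀ y ∈ Metric.ball y₀ r, (y, s₀ + δ / 2) ∈ D := by
    obtain ⟨y₁, hy₁, hs₁⟩ := hne
    have hδ2 : |s₀ + δ / 2 - s₀| < δ := by
      rw [add_sub_cancel_left, abs_of_pos (by linarith)]; linarith
    have hlt : ∀ y ∈ Metric.ball y₀ r, f y < s₀ + δ / 2 := fun y hy => by
      linarith [(abs_lt.1 (hf y hy)).2]
    have hpre : IsPreconnected ((fun y : E => (y, s₀ + δ / 2)) '' Metric.ball y₀ r) :=
      (convex_ball y₀ r).isPreconnected.image _ (by fun_prop)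
    intro y hy
    refine subset_of_disjoint_frontier hpre hD
      ⟨_, ⟨y₁, hy₁, rfl⟩, hvert y₁ hy₁ hs₁ _ hδ2 (hlt y₁ hy₁)⟩ ?_ ⟨y, hy, rfl⟩
    rintro _ ⟨t, ht, rfl⟩ hfront
    exact (hlt t ht).ne' ((hfr t ht _ hδ2).1 hfront)
  intro y hy s hs
  have hδ2 : |s₀ + δ / 2 - s₀| < δ := by
    rw [add_sub_cancel_left, abs_of_pos (by linarith)]; linarith
  have hb := abs_lt.1 (hf y hy)
  refine ⟨fun h => ?_, fun h => hvert y hy ⟨_, hδ2, by linarith, htop y hy⟩ s hs h⟩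
  -- Otherwise the convex vertical slice of `D` would contain the graph point, which is in the
  -- frontier of the open set `D`.
  by_contra! hle
  have hmem : (y, f y) ∈ D := by
    have hcv : Convex ℝ {s : ℝ | (y, s) ∈ D} := by
      intro a ha b hb u v hu hv huv
      have := hDc ha hb hu hv huv
      simpa [← add_smul, huv] using this
    exact hcv.ordConnected.out h (htop y hy) ⟨hle, by linarith⟩
  have := (hfr y hy (f y) ((hf y hy).trans (by linarith))).2 rfl
  rw [frontier, hD.interior_eq] at this
  exact this.2 hmem

/-- A convex open set whose frontier is locally a graph lies locally on one side of it. -/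
theorem exists_side_of_frontier_graph {D : Set (E × ℝ)} (hD : IsOpen D) (hDc : Convex ℝ D)
    {f : E → ℝ} {y₀ : E} (hf : ContinuousAt f y₀) (h₀ : (y₀, f y₀) ∈ closure D)
    (hfr : ∀ᶠ z in 𝓝 (y₀, f y₀), z ∈ frontier D ↔ z.2 = f z.1) :
    ∃ ε : ℝ, (ε = 1 ∨ ε = -1) ∧ ∃ r > 0, ∃ δ > 0, (∀ y ∈ Metric.ball y₀ r, |f y - f y₀| < δ) ∧
      ∀ y ∈ Metric.ball y₀ r, ∀ s, |s - f y₀| < δ → ((y, s) ∈ D ↔ ε * f y < ε * s) := by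
  obtain ⟨δ, hδ, hbox⟩ := Metric.eventually_nhds_iff_ball.1 hfr
  obtain ⟨r₁, hr₁, hr₁f⟩ := Metric.continuousAt_iff.1 hf (δ / 2) (by linarith)
  set r := min r₁ δ
  have hr : 0 < r := lt_min hr₁ hδ
  have hfr' : ∀ y ∈ Metric.ball y₀ r, ∀ s, |s - f y₀| < δ → ((y, s) ∈ frontier D ↔ s = f y) := by
    intro y hy s hs
    refine hbox (y, s) ?_
    rw [Metric.mem_ball, Prod.dist_eq]
    exact max_lt (lt_of_lt_of_le hy (min_le_right _ _)) hs
  have hf' : ∀ y ∈ Metric.ball y₀ r, |f y - f y₀| < δ / 2 := fun y hy =>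
    hr₁f (lt_of_lt_of_le hy (min_le_left _ _))
  have hN : Metric.ball y₀ r ×ˢ Metric.ball (f y₀) δ ∈ 𝓝 (y₀, f y₀) :=
    prod_mem_nhds (Metric.ball_mem_nhds _ hr) (Metric.ball_mem_nhds _ hδ)
  obtain ⟨⟨y₁, s₁⟩, ⟨hy₁, hs₁⟩, h₁⟩ := mem_closure_iff_nhds.1 h₀ _ hN
  have hs₁ : |s₁ - f y₀| < δ := hs₁
  have hne : s₁ ≠ f y₁ := by
    intro h
    have := (hfr' y₁ hy₁ s₁ hs₁).2 h
    rw [frontier, hD.interior_eq] at this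
    exact this.2 h₁
  rcases lt_or_gt_of_ne hne with hlt | hgt
  -- When `D` has a point below the graph, reflect the last coordinate and apply the previous lemma.
  · refine ⟨-1, Or.inr rfl, r, hr, δ, hδ, fun y hy => (hf' y hy).trans (by linarith), ?_⟩
    let e : E × ℝ ≃ₜ E × ℝ := (Homeomorph.refl E).prodCongr (Homeomorph.neg ℝ)
    have he : ∀ y s, e (y, s) = (y, -s) := fun y s => rfl
    have hconv : Convex ℝ (e ⁻¹' D) := by
      intro a ha b hb u v hu hv huv
      have := hDc ha hb hu hv huv
      have h2 : e (u • a + v • b) = u • e a + v • e b := by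
        refine Prod.ext rfl ?_
        change -(u • a.2 + v • b.2) = u • -a.2 + v • -b.2
        simp only [smul_eq_mul]; ring
      change e _ ∈ D
      rwa [h2]
    have hflip : ∀ s, |s - -f y₀| = |-s - f y₀| := fun s => by
      rw [← abs_neg]; congr 1; ring
    have key := mem_iff_lt_of_frontier_graph (hD.preimage e.continuous) hconv (f := fun y => -f y)
      (y₀ := y₀) (s₀ := -f y₀) (r := r) hδ
      (fun y hy => by rw [hflip, neg_neg]; exact hf' y hy)
      (fun y hy s hs => by
        rw [← e.preimage_frontier, Set.mem_preimage, he,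
          hfr' y hy (-s) (by rwa [← hflip]), neg_eq_iff_eq_neg])
      ⟨y₁, hy₁, -s₁, by rwa [hflip, neg_neg], by linarith, by
        rw [Set.mem_preimage, he, neg_neg]; exact h₁⟩
    intro y hy s hs
    have := key y hy (-s) (by rwa [hflip, neg_neg])
    rw [Set.mem_preimage, he, neg_neg] at this
    rw [this, neg_one_mul, neg_one_mul]
  · refine ⟨1, Or.inl rfl, r, hr, δ, hδ, fun y hy => (hf' y hy).trans (by linarith), ?_⟩
    have key := mem_iff_lt_of_frontier_graph hD hDc hδ hf' hfr' ⟨y₁, hy₁, s₁, hs₁, hgt, h₁⟩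
    intro y hy s hs
    rw [key y hy s hs, one_mul, one_mul]

/-- A function whose epigraph is, inside a box, a convex set is convex. -/
theorem convexOn_of_epigraph {D : Set (E × ℝ)} (hDc : Convex ℝ D) {f : E → ℝ} {y₀ : E}
    {s₀ r δ : ℝ} (hf : ∀ y ∈ Metric.ball y₀ r, |f y - s₀| < δ)
    (hD : ∀ y ∈ Metric.ball y₀ r, ∀ s, |s - s₀| < δ → ((y, s) ∈ D ↔ f y < s)) :
    ConvexOn ℝ (Metric.ball y₀ r) f := by
  refine ⟨convex_ball _ _, fun a ha b hb u v hu hv huv => ?_⟩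
  have hab := convex_ball y₀ r ha hb hu hv huv
  have hfa := abs_lt.1 (hf a ha)
  have hfb := abs_lt.1 (hf b hb)
  refine le_of_forall_pos_lt_add fun η hη => ?_
  -- Graph points are not in `D`, so both ends are raised by `t`, small enough to stay in the box
  -- and to cost less than `η`.
  obtain ⟨t, ht0, ht⟩ : ∃ t, 0 < t ∧ t < min η (min (s₀ + δ - f a) (s₀ + δ - f b)) :=
    exists_between (lt_min hη (lt_min (by linarith) (by linarith)))
  rw [lt_min_iff, lt_min_iff] at ht
  have h1 : (a, f a + t) ∈ D := (hD a ha _ (abs_lt.2 ⟨by linarith, by linarith⟩)).2 (by linarith)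
  have h2 : (b, f b + t) ∈ D := (hD b hb _ (abs_lt.2 ⟨by linarith, by linarith⟩)).2 (by linarith)
  have h3 := hDc h1 h2 hu hv huv
  have hball : |u * (f a + t) + v * (f b + t) - s₀| < δ := by
    have hc := convex_ball s₀ δ (x := f a + t) (y := f b + t)
      (by rw [Metric.mem_ball, Real.dist_eq]; exact abs_lt.2 ⟨by linarith, by linarith⟩)
      (by rw [Metric.mem_ball, Real.dist_eq]; exact abs_lt.2 ⟨by linarith, by linarith⟩) hu hv huv
    simpa [Real.dist_eq] using hc
  have h4 := (hD _ hab _ hball).1 (by simpa using h3)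
  have : u * (f a + t) + v * (f b + t) = u * f a + v * f b + t := by linear_combination t * huv
  simp only [smul_eq_mul]
  linarith

end Graph

/-! ### Derivatives of convex functions. -/

section Derivatives

variable {E : Type*} [NormedAddCommGroup E] [NormedSpace ℝ E]

theorem hasDerivAt_comp_line {G : Type*} [NormedAddCommGroup G] [NormedSpace ℝ G] {f : E → G}
    {y v : E} {t : ℝ} (hf : DifferentiableAt ℝ f (y + t • v)) :
    HasDerivAt (fun t : ℝ => f (y + t • v)) (fderiv ℝ f (y + t • v) v) t := by
  have h : HasDerivAt (fun t : ℝ => y + t • v) v t := by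
    simpa using ((hasDerivAt_id t).smul_const v).const_add y
  exact hf.hasFDerivAt.comp_hasDerivAt t h

/-- The difference quotients along the segment from `x` to `y` are at most `f y - f x`; let the
parameter tend to `0` from the right. -/
theorem _root_.ConvexOn.add_fderiv_apply_sub_le {s : Set E} {f : E → ℝ} (hf : ConvexOn ℝ s f) {x y : E}
    (hx : x ∈ s) (hy : y ∈ s) (hd : DifferentiableAt ℝ f x) :
    f x + fderiv ℝ f x (y - x) ≤ f y := by
  have hd' : HasDerivAt (fun t : ℝ => f (x + t • (y - x))) (fderiv ℝ f x (y - x)) 0 := by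
    simpa using hasDerivAt_comp_line (f := f) (y := x) (v := y - x) (t := 0) (by simpa using hd)
  have hlim := hd'.hasDerivWithinAt (s := Set.Ioi 0)
  rw [hasDerivWithinAt_iff_tendsto_slope' (by simp)] at hlim
  have := le_of_tendsto hlim (b := f y - f x) ?_
  · linarith
  · have h1 : ∀ᶠ t : ℝ in 𝓝[>] 0, t < 1 := eventually_nhdsWithin_of_eventually_nhds
      (eventually_lt_nhds one_pos)
    filter_upwards [self_mem_nhdsWithin, h1] with t (ht : 0 < t) ht1
    have hc := hf.2 hx hy (show (0 : ℝ) ≤ 1 - t by linarith) ht.le (by ring)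
    have hpt : (1 - t) • x + t • y = x + t • (y - x) := by module
    rw [hpt] at hc
    simp only [smul_eq_mul] at hc
    rw [slope_def_field, div_le_iff₀ (by linarith)]
    simp only [zero_smul, add_zero, sub_zero]
    linarith

/-- Adding the tangent inequalities at `x` and at `x + t • v` shows that the derivative in the
direction `v` increases along the line, so its difference quotients are nonnegative. -/
theorem _root_.ConvexOn.fderiv_fderiv_apply_nonneg {s : Set E} (hs : IsOpen s) {f : E → ℝ}
    (hf : ConvexOn ℝ s f) (hd : DifferentiableOn ℝ f s) {x : E} (hx : x ∈ s)
    (hd2 : DifferentiableAt ℝ (fderiv ℝ f) x) (v : E) :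
    0 ≤ fderiv ℝ (fderiv ℝ f) x v v := by
  have hd' : HasDerivAt (fun t : ℝ => fderiv ℝ f (x + t • v) v) (fderiv ℝ (fderiv ℝ f) x v v) 0 := by
    have := hasDerivAt_comp_line (f := fderiv ℝ f) (y := x) (v := v) (t := 0) (by simpa using hd2)
    simpa using this.clm_apply (hasDerivAt_const (0 : ℝ) v)
  have hlim := hd'.hasDerivWithinAt (s := Set.Ioi 0)
  rw [hasDerivWithinAt_iff_tendsto_slope' (by simp)] at hlim
  refine ge_of_tendsto hlim ?_
  have hc : Continuous fun t : ℝ => x + t • v := by fun_prop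
  have hmem : ∀ᶠ t : ℝ in 𝓝[>] 0, x + t • v ∈ s :=
    ((hc.tendsto' 0 x (by simp)).mono_left nhdsWithin_le_nhds).eventually (hs.mem_nhds hx)
  filter_upwards [self_mem_nhdsWithin, hmem] with t (ht : 0 < t) htm
  rw [slope_def_field]
  refine div_nonneg ?_ (by linarith)
  have h1 := hf.add_fderiv_apply_sub_le hx htm (hd.differentiableAt (hs.mem_nhds hx))
  have h2 := hf.add_fderiv_apply_sub_le htm hx (hd.differentiableAt (hs.mem_nhds htm))
  have e1 : x + t • v - x = t • v := by abel
  have e2 : x - (x + t • v) = -(t • v) := by abel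
  rw [e1, map_smul, smul_eq_mul] at h1
  rw [e2, map_neg, map_smul, smul_eq_mul] at h2
  rw [zero_smul, add_zero]
  have : 0 ≤ t * (fderiv ℝ f (x + t • v) v - fderiv ℝ f x v) := by linarith
  exact nonneg_of_mul_nonneg_right this ht

/-- Second order Taylor expansion along a line. -/
theorem tendsto_taylor_two_line {s : Set E} (hs : IsOpen s) {f : E → ℝ}
    (hd : DifferentiableOn ℝ f s) {x : E} (hx : x ∈ s)
    (hd2 : DifferentiableAt ℝ (fderiv ℝ f) x) (v : E) :
    Tendsto (fun h : ℝ => (f (x + h • v) - f x - h * fderiv ℝ f x v) / h ^ 2) (𝓝[>] 0)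
      (𝓝 (fderiv ℝ (fderiv ℝ f) x v v / 2)) := by
  have hc : Continuous fun t : ℝ => x + t • v := by fun_prop
  have hmem : ∀ᶠ t : ℝ in 𝓝[>] 0, x + t • v ∈ s :=
    ((hc.tendsto' 0 x (by simp)).mono_left nhdsWithin_le_nhds).eventually (hs.mem_nhds hx)
  have hd' : HasDerivAt (fun t : ℝ => fderiv ℝ f (x + t • v) v) (fderiv ℝ (fderiv ℝ f) x v v) 0 := by
    have := hasDerivAt_comp_line (f := fderiv ℝ f) (y := x) (v := v) (t := 0) (by simpa using hd2)
    simpa using this.clm_apply (hasDerivAt_const (0 : ℝ) v)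
  have hlim := hd'.hasDerivWithinAt (s := Set.Ioi 0)
  rw [hasDerivWithinAt_iff_tendsto_slope' (by simp)] at hlim
  have hcont : ContinuousAt (fun h : ℝ => f (x + h • v) - f x - h * fderiv ℝ f x v) 0 := by
    have h1 : ContinuousAt f (x + (0 : ℝ) • v) := by
      simpa using (hd.differentiableAt (hs.mem_nhds hx)).continuousAt
    have h2 : ContinuousAt (fun h : ℝ => f (x + h • v)) 0 := ContinuousAt.comp (f := fun h : ℝ => x + h • v) (x := 0) h1 hc.continuousAt
    fun_prop
  -- After one use of L'Hôpital's rule the quotient is half the slope of the first derivative at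
  -- `0`, so the second derivative is needed at `x` alone.
  refine HasDerivAt.lhopital_zero_nhdsGT (f' := fun h => fderiv ℝ f (x + h • v) v - fderiv ℝ f x v)
    (g' := fun h => 2 * h) ?_ ?_ ?_ ?_ ?_ ?_
  · filter_upwards [hmem] with h hh
    have h1 := hasDerivAt_comp_line (f := f) (hd.differentiableAt (hs.mem_nhds hh))
    have h2 : HasDerivAt (fun h : ℝ => h * fderiv ℝ f x v) (fderiv ℝ f x v) h := by
      simpa using (hasDerivAt_id h).mul_const (fderiv ℝ f x v)
    exact (h1.sub_const (f x)).sub h2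
  · filter_upwards with h
    simpa using hasDerivAt_pow 2 h
  · filter_upwards [self_mem_nhdsWithin] with h (hh : 0 < h)
    positivity
  · simpa using hcont.tendsto.mono_left (nhdsWithin_le_nhds (s := Set.Ioi 0))
  · have : Continuous fun h : ℝ => h ^ 2 := by fun_prop
    exact (this.tendsto' 0 0 (by simp)).mono_left nhdsWithin_le_nhds
  · refine (hlim.div_const 2).congr fun h => ?_
    rw [slope_def_field]
    simp only [zero_smul, add_zero, sub_zero]
    rw [div_div, mul_comm h 2]

/-- A positive semidefinite nondegenerate symmetric bilinear form is positive definite. -/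
theorem pos_of_nonneg_of_injective {q : E →L[ℝ] E →L[ℝ] ℝ} (hsymm : ∀ v w, q v w = q w v)
    (hnonneg : ∀ v, 0 ≤ q v v) (hinj : Function.Injective q) {v : E} (hv : v ≠ 0) : 0 < q v v := by
  refine lt_of_le_of_ne (hnonneg v) fun h0 => hv (hinj ?_)
  ext w
  -- Since `q v v = 0`, the form at `t • v + w` is affine in `t`; being nonnegative, it has zero
  -- slope. The value of `t` used below would make it `-1`.
  have h : ∀ t : ℝ, 0 ≤ 2 * t * q v w + q w w := fun t => by
    have := hnonneg (t • v + w)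
    simp only [map_add, map_smul, add_apply, smul_apply,
      smul_eq_mul, ← h0, hsymm w v] at this
    linarith
  rw [map_zero, zero_apply]
  by_contra hne
  have := h (-(q w w + 1) / (2 * q v w))
  have e : 2 * (-(q w w + 1) / (2 * q v w)) * q v w = -(q w w + 1) := by field_simp
  linarith

end Derivatives

/-! ### A point with nondegenerate Hessian. -/

section Hessian

variable {E : Type*} [NormedAddCommGroup E] [InnerProductSpace ℝ E] [FiniteDimensional ℝ E]

/-- The differentials of a strictly convex differentiable function contain an open set. -/
theorem exists_ball_subset_image_fderiv {f : E → ℝ} {y₀ : E} {r : ℝ} (hr : 0 < r)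
    (hd : DifferentiableOn ℝ f (Metric.ball y₀ r))
    (hstrict : ∀ y ∈ Metric.ball y₀ r, y ≠ y₀ → f y₀ + fderiv ℝ f y₀ (y - y₀) < f y) :
    ∃ η > 0, Metric.ball (fderiv ℝ f y₀) η ⊆ fderiv ℝ f '' Metric.ball y₀ r := by
  have hr2 : 0 < r / 2 := by linarith
  have hsub : Metric.closedBall y₀ (r / 2) ⊆ Metric.ball y₀ r :=
    Metric.closedBall_subset_ball (by linarith)
  have hcont : ∀ p : E →L[ℝ] ℝ,
      ContinuousOn (fun y => f y - f y₀ - p (y - y₀)) (Metric.closedBall y₀ (r / 2)) := by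
    intro p
    have := hd.continuousOn.mono hsub
    fun_prop
  obtain ⟨m, hm, hmf⟩ : ∃ m > 0, ∀ y ∈ Metric.sphere y₀ (r / 2),
      m ≤ f y - f y₀ - fderiv ℝ f y₀ (y - y₀) := by
    -- The sphere is empty when `E` is trivial, which occurs for `n = 1`.
    rcases (Metric.sphere y₀ (r / 2)).eq_empty_or_nonempty with he | hne
    · exact ⟨1, one_pos, by simp [he]⟩
    · obtain ⟨y₁, hy₁, hmin⟩ := (isCompact_sphere y₀ (r / 2)).exists_isMinOn hne
        ((hcont (fderiv ℝ f y₀)).mono Metric.sphere_subset_closedBall)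
      refine ⟨f y₁ - f y₀ - fderiv ℝ f y₀ (y₁ - y₀), ?_, fun y hy => hmin hy⟩
      have := hstrict y₁ (hsub (Metric.sphere_subset_closedBall hy₁)) (by
        rintro rfl; simp at hy₁; linarith)
      linarith
  -- Changing the differential by less than `m / r` alters values on the sphere of radius `r / 2` by
  -- at most `m / 2`. They stay positive there, while the centre has value `0`, so the minimum is
  -- interior and critical.
  refine ⟨m / r, by positivity, fun p hp => ?_⟩
  obtain ⟨y₁, hy₁, hmin⟩ := (isCompact_closedBall y₀ (r / 2)).exists_isMinOn
    (Metric.nonempty_closedBall.2 hr2.le) (hcont p)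
  have h0 : f y₁ - f y₀ - p (y₁ - y₀) ≤ 0 := by
    simpa using hmin (Metric.mem_closedBall_self hr2.le)
  have hint : y₁ ∈ Metric.ball y₀ (r / 2) := by
    rw [Metric.mem_ball]
    refine lt_of_le_of_ne hy₁ fun heq => ?_
    have h1 := hmf y₁ heq
    have h2 : |(p - fderiv ℝ f y₀) (y₁ - y₀)| ≤ m / r * (r / 2) := by
      rw [← Real.norm_eq_abs]
      refine (ContinuousLinearMap.le_opNorm _ _).trans ?_
      rw [← dist_eq_norm y₁ y₀, heq, ← dist_eq_norm p]
      exact mul_le_mul_of_nonneg_right (le_of_lt hp) hr2.le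
    have h3 : m / r * (r / 2) = m / 2 := by field_simp
    have h4 := (abs_le.1 h2).2
    rw [sub_apply] at h4
    linarith
  have hy₁' : y₁ ∈ Metric.ball y₀ r := hsub hy₁
  refine ⟨y₁, hy₁', ?_⟩
  have hloc : IsLocalMin (fun y => f y - f y₀ - p (y - y₀)) y₁ :=
    hmin.isLocalMin (Filter.mem_of_superset (Metric.isOpen_ball.mem_nhds hint)
      Metric.ball_subset_closedBall)
  have hder : HasFDerivAt (fun y => f y - f y₀ - p (y - y₀)) (fderiv ℝ f y₁ - p) y₁ := by
    have h1 := (hd.differentiableAt (Metric.isOpen_ball.mem_nhds hy₁')).hasFDerivAt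
    have h2 : HasFDerivAt (fun y => p (y - y₀)) p y₁ :=
      p.hasFDerivAt.comp y₁ ((hasFDerivAt_id y₁).sub_const y₀)
    exact (h1.sub_const (f y₀)).sub h2
  exact sub_eq_zero.1 (hloc.hasFDerivAt_eq_zero hder)

open MeasureTheory in
/-- A twice differentiable, strictly convex function has a point with nondegenerate Hessian. -/
theorem exists_injective_fderiv_fderiv {f : E → ℝ} {y₀ : E} {r : ℝ} (hr : 0 < r)
    (hd : TwiceDifferentiableOn f (Metric.ball y₀ r))
    (hstrict : ∀ y ∈ Metric.ball y₀ r, y ≠ y₀ → f y₀ + fderiv ℝ f y₀ (y - y₀) < f y) :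
    ∃ y ∈ Metric.ball y₀ r, Function.Injective (fderiv ℝ (fderiv ℝ f) y) := by
  by_contra! hcon
  borelize E
  -- Identifying the dual with `E` turns the differential into a map from `E` to itself, whose
  -- derivative has a determinant.
  let J : (E →L[ℝ] ℝ) →L[ℝ] E :=
    LinearMap.toContinuousLinearMap
      { toFun := (InnerProductSpace.toDual ℝ E).symm
        map_add' := map_add _
        map_smul' := fun c p => by simp }
  have hJ : Function.Injective J := (InnerProductSpace.toDual ℝ E).symm.injective
  have hz : volume ((fun y => J (fderiv ℝ f y)) '' Metric.ball y₀ r) = 0 := by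
    refine addHaar_image_eq_zero_of_det_fderivWithin_eq_zero (μ := volume)
      (f' := fun y => J.comp (fderiv ℝ (fderiv ℝ f) y)) (fun y hy => ?_) (fun y hy => ?_)
    · exact (J.hasFDerivAt.comp y
        (hd.2.differentiableAt (Metric.isOpen_ball.mem_nhds hy)).hasFDerivAt).hasFDerivWithinAt
    · by_contra hdet
      refine hcon y hy fun a b hab => ?_
      have hu := ((LinearMap.equivOfDetNeZero
        (J.comp (fderiv ℝ (fderiv ℝ f) y)).toLinearMap hdet)).injective
      exact hu (congrArg J hab)
  obtain ⟨η, hη, hsub⟩ := exists_ball_subset_image_fderiv hr hd.1 hstrict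
  have hball : Metric.ball (J (fderiv ℝ f y₀)) η ⊆
      (fun y => J (fderiv ℝ f y)) '' Metric.ball y₀ r := by
    intro p hp
    have hp' : InnerProductSpace.toDual ℝ E p ∈ Metric.ball (fderiv ℝ f y₀) η := by
      rw [Metric.mem_ball, ← (InnerProductSpace.toDual ℝ E).symm.dist_map]
      rw [LinearIsometryEquiv.symm_apply_apply]
      exact hp
    obtain ⟨y, hy, hyp⟩ := hsub hp'
    refine ⟨y, hy, ?_⟩
    change (InnerProductSpace.toDual ℝ E).symm (fderiv ℝ f y) = p
    rw [hyp, LinearIsometryEquiv.symm_apply_apply]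
  exact (Metric.measure_ball_pos volume _ hη).ne' (measure_mono_null hball hz)

end Hessian

/-! ### Linear coordinates for paraboloids, and zooming. -/

/-- A positive definite bilinear form is the squared norm in suitable linear coordinates. -/
theorem exists_linearEquiv_norm_sq {W : Type*} [AddCommGroup W] [Module ℝ W]
    [FiniteDimensional ℝ W] {n : ℕ} (hn : Module.finrank ℝ W = n) (b : W →ₗ[ℝ] W →ₗ[ℝ] ℝ)
    (hb : ∀ w, w ≠ 0 → 0 < b w w) :
    ∃ e : W ≃ₗ[ℝ] EuclideanSpace ℝ (Fin n), ∀ w, ‖e w‖ ^ 2 = b w w := by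
  subst hn
  obtain ⟨w, hw, ⟨e⟩⟩ :=
    QuadraticForm.equivalent_one_zero_neg_one_weighted_sum_squared
      (LinearMap.BilinMap.toQuadraticMap b)
  -- Sylvester's weights are `1`, `0` or `-1`; positivity on basis vectors leaves only `1`.
  have hw1 : ∀ i, w i = 1 := by
    intro i
    have h := hb (e.symm (Pi.single i 1)) (by simp)
    have h2 := e.symm.map_app (Pi.single i 1)
    rw [LinearMap.BilinMap.toQuadraticMap_apply] at h2
    rw [h2, QuadraticMap.weightedSumSquares_apply] at h
    rcases hw i with h' | h' | h' <;> simp [Pi.single_apply, h'] at h ⊢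
    linarith
  refine ⟨e.toLinearEquiv.trans (WithLp.linearEquiv 2 ℝ (Fin _ → ℝ)).symm, fun v => ?_⟩
  rw [← LinearMap.BilinMap.toQuadraticMap_apply, ← e.map_app,
    QuadraticMap.weightedSumSquares_apply, EuclideanSpace.norm_sq_eq]
  refine Finset.sum_congr rfl fun i _ => ?_
  rw [hw1, one_smul, Real.norm_eq_abs, sq_abs, sq]
  rfl

section Coordinates

variable {E : Type*} [NormedAddCommGroup E] [NormedSpace ℝ E]

/-- Linear coordinates taking the cone over an elliptic paraboloid to the cone over a ball. -/
theorem exists_linearEquiv_paraboloid [FiniteDimensional ℝ E] {n : ℕ}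
    (hn : Module.finrank ℝ E + 1 = n) (q : E →L[ℝ] E →L[ℝ] ℝ) (hq : ∀ v, v ≠ 0 → 0 < q v v) :
    ∃ ρ : (ℝ × E × ℝ) ≃ₗ[ℝ] (ℝ × EuclideanSpace ℝ (Fin n)), ∀ a y s,
      (ρ (a, y, s)).1 = a + s ∧ ‖(ρ (a, y, s)).2‖ ^ 2 = 2 * q y y + (a - s) ^ 2 := by
  let b : (E × ℝ) →ₗ[ℝ] (E × ℝ) →ₗ[ℝ] ℝ :=
    LinearMap.mk₂ ℝ (fun w w' => 2 * q w.1 w'.1 + w.2 * w'.2)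
      (fun _ _ _ => by simp; ring) (fun _ _ _ => by simp; ring)
      (fun _ _ _ => by simp; ring) (fun _ _ _ => by simp; ring)
  obtain ⟨e, he⟩ := exists_linearEquiv_norm_sq (n := n) (by simpa using hn) b (by
    rintro ⟨y, d⟩ hw
    simp only [b, LinearMap.mk₂_apply]
    by_cases hy : y = 0
    · have hd : d ≠ 0 := by rintro rfl; exact hw (by simp [hy])
      have := mul_self_pos.2 hd
      simpa [hy] using this
    · have := hq y hy
      nlinarith [mul_self_nonneg d])
  -- From `(a + s) ^ 2 - (a - s) ^ 2 = 4 * a * s`, the ball condition `2 * q y y + (a - s) ^ 2 < (a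
  -- + s) ^ 2` reads `q y y < 2 * a * s`.
  let σ : (ℝ × E × ℝ) ≃ₗ[ℝ] (ℝ × E × ℝ) :=
    { toFun := fun z => (z.1 + z.2.2, z.2.1, z.1 - z.2.2)
      map_add' := fun x y => by ext <;> simp <;> ring
      map_smul' := fun c x => by ext <;> simp <;> ring
      invFun := fun z => ((z.1 + z.2.2) / 2, z.2.1, (z.1 - z.2.2) / 2)
      left_inv := fun z => by ext <;> simp
      right_inv := fun z => by ext <;> simp <;> ring }
  refine ⟨σ.trans ((LinearEquiv.refl ℝ ℝ).prodCongr e), fun a y s => ⟨rfl, ?_⟩⟩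
  change ‖e (y, a - s)‖ ^ 2 = _
  rw [he]
  simp only [b, LinearMap.mk₂_apply]
  ring

/-- Zooming in, with factors `h⁻¹` and `h⁻²`, at a point of a hypersurface with given tangent. -/
noncomputable def zoom (y₀ : E) (s₀ : ℝ) (p : E →L[ℝ] ℝ) (h : ℝ) (hh : h ≠ 0) :
    (ℝ × E × ℝ) ≃ₗ[ℝ] (ℝ × E × ℝ) where
  toFun z := (z.1, z.1 • y₀ + h • z.2.1, z.1 * s₀ + h * p z.2.1 + h ^ 2 * z.2.2)
  map_add' x y := by
    refine Prod.ext rfl (Prod.ext ?_ ?_)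
    · simp only [Prod.fst_add, Prod.snd_add]; module
    · simp only [Prod.fst_add, Prod.snd_add, map_add]; ring
  map_smul' c x := by
    refine Prod.ext rfl (Prod.ext ?_ ?_)
    · simp only [Prod.smul_fst, Prod.smul_snd, smul_eq_mul, RingHom.id_apply]; module
    · simp only [Prod.smul_fst, Prod.smul_snd, smul_eq_mul, RingHom.id_apply, map_smul]; ring
  invFun z := (z.1, h⁻¹ • (z.2.1 - z.1 • y₀),
    (h ^ 2)⁻¹ * (z.2.2 - z.1 * s₀ - p (z.2.1 - z.1 • y₀)))
  left_inv z := by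
    refine Prod.ext rfl (Prod.ext ?_ ?_)
    · simp [smul_smul, hh]
    · simp only [add_sub_cancel_left, map_smul, smul_eq_mul]; field_simp; ring
  right_inv z := by
    refine Prod.ext rfl (Prod.ext ?_ ?_)
    · simp [smul_smul, hh]
    · simp only [map_smul, smul_eq_mul]; field_simp; ring

theorem zoom_apply (y₀ : E) (s₀ : ℝ) (p : E →L[ℝ] ℝ) (h : ℝ) (hh : h ≠ 0) (a : ℝ) (y : E) (s : ℝ) :
    zoom y₀ s₀ p h hh (a, y, s) = (a, a • y₀ + h • y, a * s₀ + h * p y + h ^ 2 * s) := rfl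

variable {V : Type*} [NormedAddCommGroup V] [NormedSpace ℝ V] {K : Set V}

/-- If a cone is locally the part above a graph, then points of the graph are in its frontier. -/
theorem mem_frontier_of_graph [FiniteDimensional ℝ E] (hK : IsOpenConvexCone K)
    (Θ : (ℝ × E × ℝ) ≃ₗ[ℝ] V)
    {f : E → ℝ} {y : E} {s₀ δ : ℝ} (hf : |f y - s₀| < δ)
    (hgraph : ∀ s, |s - s₀| < δ → (Θ (1, y, s) ∈ K ↔ f y < s)) :
    Θ (1, y, f y) ∈ frontier K := by
  rw [hK.frontier_eq]
  refine ⟨?_, fun h => lt_irrefl _ ((hgraph _ hf).1 h)⟩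
  have hc : Continuous fun s : ℝ => Θ (1, y, s) :=
    Θ.toLinearMap.continuous_of_finiteDimensional.comp (by fun_prop)
  refine mem_closure_of_tendsto (b := 𝓝[>] (f y))
    ((hc.tendsto (f y)).mono_left nhdsWithin_le_nhds) ?_
  have hc2 : Continuous fun s : ℝ => |s - s₀| := by fun_prop
  have hnear : ∀ᶠ s in 𝓝[>] (f y), |s - s₀| < δ :=
    ((hc2.tendsto (f y)).mono_left nhdsWithin_le_nhds).eventually (gt_mem_nhds hf)
  filter_upwards [hnear, self_mem_nhdsWithin] with s hs hs'
  exact (hgraph s hs).2 hs'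

/-- If the frontier of a cone contains no segment and is locally the graph of a convex function,
then the graph is strictly above its tangents. -/
theorem lt_of_no_segment [FiniteDimensional ℝ E] (hK : IsOpenConvexCone K)
    (hseg : ¬ ∃ a b : V, LinearIndependent ℝ ![a, b] ∧ ∀ v ∈ segment ℝ a b, v ∈ frontier K)
    (Θ : (ℝ × E × ℝ) ≃ₗ[ℝ] V) {f : E → ℝ} {y₀ : E} {s₀ r δ : ℝ}
    (hf : ∀ y ∈ Metric.ball y₀ r, |f y - s₀| < δ)
    (hgraph : ∀ y ∈ Metric.ball y₀ r, ∀ s, |s - s₀| < δ → (Θ (1, y, s) ∈ K ↔ f y < s))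
    (hconv : ConvexOn ℝ (Metric.ball y₀ r) f) {x y : E} (hx : x ∈ Metric.ball y₀ r)
    (hd : DifferentiableAt ℝ f x)
    (hy : y ∈ Metric.ball y₀ r) (hxy : y ≠ x) : f x + fderiv ℝ f x (y - x) < f y := by
  refine lt_of_le_of_ne (hconv.add_fderiv_apply_sub_le hx hy hd) fun heq => hseg ?_
  refine ⟨Θ (1, x, f x), Θ (1, y, f y), ?_, ?_⟩
  · rw [LinearIndependent.pair_iff]
    intro s t hst
    rw [← map_smul, ← map_smul, ← map_add, map_eq_zero_iff _ Θ.injective] at hst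
    have h1 : s + t = 0 := by simpa using congrArg Prod.fst hst
    have h2 : s • x + t • y = 0 := congrArg (fun z => z.2.1) hst
    have h3 : t • (y - x) = 0 := by
      have hs : s = -t := by linarith
      rw [hs] at h2
      rw [← h2]; module
    have ht : t = 0 := (smul_eq_zero.1 h3).resolve_right (sub_ne_zero.2 hxy)
    exact ⟨by linarith, ht⟩
  · rintro _ ⟨u, v, hu, hv, huv, rfl⟩
    have hz := convex_ball y₀ r hx hy hu hv huv
    have h1 := hconv.2 hx hy hu hv huv
    have h2 := hconv.add_fderiv_apply_sub_le hx hz hd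
    have h3 : u • x + v • y - x = v • (y - x) := by
      have : u = 1 - v := by linarith
      rw [this]; module
    rw [h3, map_smul] at h2
    simp only [smul_eq_mul] at h1 h2
    -- If the tangent at `x` meets the graph at `y`, it coincides with the chord, and `f` is
    -- squeezed between the two.
    have h4 : f (u • x + v • y) = u * f x + v * f y := by
      refine le_antisymm h1 (le_of_eq_of_le ?_ h2)
      linear_combination (f x) * huv - v * heq
    have h5 : u • Θ (1, x, f x) + v • Θ (1, y, f y) =
        Θ (1, u • x + v • y, f (u • x + v • y)) := by
      rw [← map_smul, ← map_smul, ← map_add, h4]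
      congr 1
      simp [huv]
    rw [h5]
    exact mem_frontier_of_graph hK Θ (hf _ hz) (hgraph _ hz)

/-- Rescaling to first coordinate `1` gives points tending to `(1, y₁, f y₁)`, hence eventually in
the box, where lying above the graph becomes a bound on the second order Taylor quotient. -/
theorem eventually_zoom_mem_iff (hK : IsOpenConvexCone K)
    (Θ : (ℝ × E × ℝ) ≃ₗ[ℝ] V) {f : E → ℝ} {y₀ y₁ : E} {s₀ r δ : ℝ}
    (hf : ∀ y ∈ Metric.ball y₀ r, |f y - s₀| < δ)
    (hgraph : ∀ y ∈ Metric.ball y₀ r, ∀ s, |s - s₀| < δ → (Θ (1, y, s) ∈ K ↔ f y < s))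
    (hy₁ : y₁ ∈ Metric.ball y₀ r) {a : ℝ} (ha : 0 < a) (y : E) (s : ℝ) (p : E →L[ℝ] ℝ) :
    ∀ᶠ h in 𝓝[>] (0 : ℝ), ∀ hh : h ≠ 0, (Θ (zoom y₁ (f y₁) p h hh (a, y, s)) ∈ K ↔
      (f (y₁ + h • a⁻¹ • y) - f y₁ - h * p (a⁻¹ • y)) / h ^ 2 < a⁻¹ * s) := by
  have hc : Continuous fun h : ℝ => y₁ + h • a⁻¹ • y := by fun_prop
  have hmem : ∀ᶠ h : ℝ in 𝓝[>] 0, y₁ + h • a⁻¹ • y ∈ Metric.ball y₀ r :=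
    ((hc.tendsto' 0 y₁ (by simp)).mono_left nhdsWithin_le_nhds).eventually
      (Metric.isOpen_ball.mem_nhds hy₁)
  have hc2 : Continuous fun h : ℝ => |f y₁ + h * p (a⁻¹ • y) + h ^ 2 * (a⁻¹ * s) - s₀| := by
    fun_prop
  have hmem2 : ∀ᶠ h : ℝ in 𝓝[>] 0, |f y₁ + h * p (a⁻¹ • y) + h ^ 2 * (a⁻¹ * s) - s₀| < δ :=
    ((hc2.tendsto' 0 |f y₁ - s₀| (by simp)).mono_left nhdsWithin_le_nhds).eventually
      (gt_mem_nhds (hf y₁ hy₁))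
  filter_upwards [hmem, hmem2, self_mem_nhdsWithin] with h h1 h2 (h3 : 0 < h) hh
  have e1 : zoom y₁ (f y₁) p h hh (a, y, s) =
      a • (1, y₁ + h • a⁻¹ • y, f y₁ + h * p (a⁻¹ • y) + h ^ 2 * (a⁻¹ * s)) := by
    rw [zoom_apply]
    refine Prod.ext (by simp) (Prod.ext ?_ ?_)
    · simp only [Prod.smul_snd, Prod.smul_fst, smul_add, smul_smul]
      congr 2; field_simp
    · simp only [Prod.smul_snd, smul_eq_mul, map_smul]
      field_simp
  rw [e1, map_smul, hK.smul_mem_iff ha, hgraph _ h1 _ h2, div_lt_iff₀ (by positivity)]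
  constructor <;> intro h <;> linarith

end Coordinates

/-! ### Blowing up at a nondegenerate point. -/

section BlowUp

variable {E : Type*} [NormedAddCommGroup E] [InnerProductSpace ℝ E] [FiniteDimensional ℝ E]
variable {V : Type*} [NormedAddCommGroup V] [NormedSpace ℝ V] [FiniteDimensional ℝ V]
  {K K₀ : Set V}

/-- A quasi-homogeneous cone whose frontier is somewhere the graph of a twice differentiable
function and contains no segment is the cone over a ball. -/
theorem exists_linearEquiv_ballCone_of_graph (hK : IsOpenConvexCone K) (hKs : IsSalient K)
    (hseg : ¬ ∃ a b : V, LinearIndependent ℝ ![a, b] ∧ ∀ v ∈ segment ℝ a b, v ∈ frontier K)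
    (hK₀ : IsCompact K₀) (hK₀K : K₀ ⊆ K)
    (hqh : ∀ x ∈ K, ∃ γ : V ≃ₗ[ℝ] V, (∀ v, γ v ∈ K ↔ v ∈ K) ∧ ∃ k ∈ K₀, γ k = x)
    (Θ : (ℝ × E × ℝ) ≃ₗ[ℝ] V) {f : E → ℝ} {y₀ : E} {s₀ r δ : ℝ} (hr : 0 < r)
    (hd : TwiceDifferentiableOn f (Metric.ball y₀ r))
    (hf : ∀ y ∈ Metric.ball y₀ r, |f y - s₀| < δ)
    (hgraph : ∀ y ∈ Metric.ball y₀ r, ∀ s, |s - s₀| < δ → (Θ (1, y, s) ∈ K ↔ f y < s))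
    {n : ℕ} (hn : Module.finrank ℝ E + 1 = n) :
    ∃ S : (ℝ × EuclideanSpace ℝ (Fin n)) ≃ₗ[ℝ] V, ∀ z, S z ∈ K ↔ z ∈ ballCone _ := by
  have hdiff : ∀ y ∈ Metric.ball y₀ r, DifferentiableAt ℝ f y := fun y hy =>
    hd.1.differentiableAt (Metric.isOpen_ball.mem_nhds hy)
  have hconv : ConvexOn ℝ (Metric.ball y₀ r) f := by
    refine convexOn_of_epigraph (D := {w : E × ℝ | Θ (1, w.1, w.2) ∈ K}) ?_ hf hgraph
    intro a ha b hb u v hu hv huv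
    have := hK.convex ha hb hu hv huv
    rw [← map_smul, ← map_smul, ← map_add] at this
    simpa [huv] using this
  have hstrict : ∀ x ∈ Metric.ball y₀ r, ∀ y ∈ Metric.ball y₀ r, y ≠ x →
      f x + fderiv ℝ f x (y - x) < f y := fun x hx y hy hxy =>
    lt_of_no_segment hK hseg Θ hf hgraph hconv hx (hdiff x hx) hy hxy
  have hy₀ : y₀ ∈ Metric.ball y₀ r := Metric.mem_ball_self hr
  obtain ⟨y₁, hy₁, hinj⟩ := exists_injective_fderiv_fderiv hr hd (hstrict y₀ hy₀)
  have hd2 : DifferentiableAt ℝ (fderiv ℝ f) y₁ :=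
    hd.2.differentiableAt (Metric.isOpen_ball.mem_nhds hy₁)
  set q := fderiv ℝ (fderiv ℝ f) y₁ with hqdef
  have hqs : ∀ v w, q v w = q w v := second_derivative_symmetric_of_eventually (𝕜 := ℝ) (f := f)
    (by
      filter_upwards [Metric.isOpen_ball.mem_nhds hy₁] with y hy
      exact (hdiff y hy).hasFDerivAt) hd2.hasFDerivAt
  have hqnn : ∀ v, 0 ≤ q v v :=
    hconv.fderiv_fderiv_apply_nonneg Metric.isOpen_ball hd.1 hy₁ hd2
  obtain ⟨ρ, hρ⟩ := exists_linearEquiv_paraboloid hn q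
    fun v hv => pos_of_nonneg_of_injective hqs hqnn hinj hv
  set p := fderiv ℝ f y₁ with hpdef
  let h : ℕ → ℝ := fun j => 1 / ((j : ℝ) + 1)
  have hh : ∀ j, 0 < h j := fun j => Nat.one_div_pos_of_nat
  have hlim : Tendsto h atTop (𝓝[>] 0) :=
    tendsto_nhdsWithin_iff.2 ⟨tendsto_one_div_add_atTop_nhds_zero_nat,
      Eventually.of_forall fun j => hh j⟩
  let Z : ℕ → (ℝ × E × ℝ) ≃ₗ[ℝ] V := fun j => (zoom y₁ (f y₁) p (h j) (hh j).ne').trans Θ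
  have hZpos : ∀ a y s, 0 < a → ∀ᶠ j in atTop, (Z j (a, y, s) ∈ K ↔
      (f (y₁ + h j • a⁻¹ • y) - f y₁ - h j * p (a⁻¹ • y)) / h j ^ 2 < a⁻¹ * s) := by
    intro a y s ha
    filter_upwards [hlim.eventually
      (eventually_zoom_mem_iff hK Θ hf hgraph hy₁ ha y s p)] with j hj using hj _
  have hTay : ∀ v, Tendsto (fun j => (f (y₁ + h j • v) - f y₁ - h j * p v) / h j ^ 2) atTop
      (𝓝 (q v v / 2)) := fun v =>
    (tendsto_taylor_two_line Metric.isOpen_ball hd.1 hy₁ hd2 v).comp hlim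
  have hin : ∀ a y s, 0 < a → q y y < 2 * a * s → ∀ᶠ j in atTop, Z j (a, y, s) ∈ K := by
    intro a y s ha hlt
    have : q (a⁻¹ • y) (a⁻¹ • y) / 2 < a⁻¹ * s := by
      simp only [map_smul, smul_apply, smul_eq_mul]
      field_simp
      linarith
    filter_upwards [hZpos a y s ha, (hTay (a⁻¹ • y)).eventually (gt_mem_nhds this)] with j h1 h2
    exact h1.2 h2
  have hout : ∀ a y s, 0 < a → (∃ᶠ j in atTop, Z j (a, y, s) ∈ K) → q y y ≤ 2 * a * s := by
    intro a y s ha hfr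
    by_contra! hlt
    have : a⁻¹ * s < q (a⁻¹ • y) (a⁻¹ • y) / 2 := by
      simp only [map_smul, smul_apply, smul_eq_mul]
      field_simp
      linarith
    refine hfr ?_
    filter_upwards [hZpos a y s ha, (hTay (a⁻¹ • y)).eventually (lt_mem_nhds this)] with j h1 h2
    exact fun hmem => lt_asymm h2 (h1.1 hmem)
  -- These points tend to a negative multiple of a nonzero frontier vector, which salience keeps out
  -- of the closure of `K`.
  have hneg : ∀ a y s, a < 0 → ∀ᶠ j in atTop, Z j (a, y, s) ∉ K := by
    intro a y s ha
    have hfront := mem_frontier_of_graph hK Θ (hf y₁ hy₁) (hgraph y₁ hy₁)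
    rw [hK.frontier_eq] at hfront
    have hnot : a • Θ (1, y₁, f y₁) ∉ closure K := by
      intro hmem
      have h1 := hK.smul_mem_closure (inv_pos.2 (neg_pos.2 ha)) hmem
      rw [smul_smul, inv_neg, neg_mul, inv_mul_cancel₀ ha.ne, neg_smul, one_smul] at h1
      have h2 := hKs _ hfront.1 h1
      rw [map_eq_zero_iff _ Θ.injective] at h2
      simpa using congrArg Prod.fst h2
    have hc : Continuous fun t : ℝ =>
        Θ (a, a • y₁ + t • y, a * f y₁ + t * p y + t ^ 2 * s) :=
      Θ.toLinearMap.continuous_of_finiteDimensional.comp (by fun_prop)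
    have ht := (hc.tendsto' 0 (a • Θ (1, y₁, f y₁)) (by rw [← map_smul]; simp)).comp
      (hlim.mono_right nhdsWithin_le_nhds)
    filter_upwards [ht.eventually (isClosed_closure.isOpen_compl.mem_nhds hnot)] with j hj hmem
    exact hj (subset_closure hmem)
  have hcl : ∀ a y s, 0 < a → (∃ᶠ j in atTop, Z j (a, y, s) ∈ K) →
      ρ (a, y, s) ∈ closure (ballCone (EuclideanSpace ℝ (Fin n))) := by
    intro a y s ha hfr
    have h1 := hout a y s ha hfr
    rw [mem_closure_ballCone, (hρ a y s).1]
    have hs : 0 ≤ s := by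
      by_contra! hs
      nlinarith [hqnn y]
    refine abs_le_of_sq_le_sq' ?_ (by linarith) |>.2
    rw [(hρ a y s).2]
    nlinarith
  refine exists_linearEquiv_of_limit hK hKs isOpenConvexCone_ballCone isSalient_ballCone hK₀ hK₀K
    hqh (fun j => ρ.symm.trans (Z j)) ?_ ?_
  · intro z hz
    obtain ⟨⟨a, y, s⟩, rfl⟩ := ρ.surjective z
    simp only [LinearEquiv.trans_apply, LinearEquiv.symm_apply_apply]
    have h1 : ‖(ρ (a, y, s)).2‖ < (ρ (a, y, s)).1 := hz
    have h2 := mul_self_lt_mul_self (norm_nonneg _) h1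
    have h3 := (norm_nonneg _).trans_lt h1
    rw [← sq, (hρ a y s).2, (hρ a y s).1] at h2
    rw [(hρ a y s).1] at h3
    have h4 : q y y < 2 * a * s := by nlinarith
    have h5 : 0 < a := by
      by_contra! h6
      nlinarith [hqnn y]
    exact hin a y s h5 h4
  · intro z hz
    obtain ⟨⟨a, y, s⟩, rfl⟩ := ρ.surjective z
    simp only [LinearEquiv.trans_apply, LinearEquiv.symm_apply_apply] at hz
    rcases lt_trichotomy a 0 with ha | rfl | ha
    · exact absurd (hneg a y s ha) hz
    -- The Taylor comparison needs `a > 0`. Adding `ε • (1, 0, 1)`, a vector interior to the limit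
    -- cone, reduces to that case; then `ε` tends to `0`.
    · have hlim0 : Tendsto (fun ε : ℝ => ρ (0, y, s) + ε • ρ (1, 0, 1)) (𝓝[>] 0)
          (𝓝 (ρ (0, y, s))) := by
        have : Continuous fun ε : ℝ => ρ (0, y, s) + ε • ρ (1, 0, 1) := by fun_prop
        exact (this.tendsto' 0 _ (by simp)).mono_left nhdsWithin_le_nhds
      refine isClosed_closure.mem_of_tendsto hlim0 ?_
      filter_upwards [self_mem_nhdsWithin] with ε (hε : 0 < ε)
      have e1 : (0, y, s) + ε • ((1 : ℝ), (0 : E), (1 : ℝ)) = (ε, y, s + ε) := by simp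
      rw [← map_smul, ← map_add, e1]
      refine hcl _ _ _ hε ?_
      refine (hz.and_eventually (hin 1 0 1 one_pos (by simp))).mono fun j hj => ?_
      rw [← e1, map_add, map_smul]
      exact hK.add_mem hj.1 (hK.smul_mem hε hj.2)
    · exact hcl a y s ha hz

end BlowUp

/-! ### From projective domains to cones. -/

section Projective

variable {n : ℕ}

/-- The projection onto projective space. -/
noncomputable def proj (v : {v : Fin (n + 1) → ℝ // v ≠ 0}) : RP n := Projectivization.mk ℝ v.1 v.2

theorem continuous_proj : Continuous (proj (n := n)) := continuous_coinduced_rng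

theorem isOpenMap_proj : IsOpenMap (proj (n := n)) := by
  intro U hU
  refine isOpen_coinduced.2 ?_
  -- The saturation of `U` is the union of its nonzero scalar multiples, each of them open.
  have h : (fun v : {v : Fin (n + 1) → ℝ // v ≠ 0} => Projectivization.mk ℝ v.1 v.2) ⁻¹'
      (proj '' U) = ⋃ c : ℝˣ, (fun v : {v : Fin (n + 1) → ℝ // v ≠ 0} =>
        (⟨c • v.1, (smul_ne_zero_iff_ne c).2 v.2⟩ : {v : Fin (n + 1) → ℝ // v ≠ 0})) ⁻¹' U := by
    ext v
    simp only [Set.mem_preimage, Set.mem_image, Set.mem_iUnion]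
    constructor
    · rintro ⟨w, hw, hwv⟩
      obtain ⟨c, hc⟩ := (Projectivization.mk_eq_mk_iff ℝ _ _ w.2 v.2).1 hwv
      exact ⟨c, by convert hw⟩
    · rintro ⟨c, hc⟩
      exact ⟨_, hc, (Projectivization.mk_eq_mk_iff ℝ _ _ _ v.2).2 ⟨c, rfl⟩⟩
  rw [h]
  refine isOpen_iUnion fun c => hU.preimage ?_
  exact Continuous.subtype_mk (by fun_prop) _

theorem mem_lift {B : Set (RP n)} {v : Fin (n + 1) → ℝ} (hv : v ≠ 0) :
    v ∈ lift B ↔ Projectivization.mk ℝ v hv ∈ B :=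
  ⟨fun ⟨_, h⟩ => h, fun h => ⟨hv, h⟩⟩

theorem smul_mem_lift {B : Set (RP n)} {v : Fin (n + 1) → ℝ} {c : ℝ} (hc : c ≠ 0) :
    c • v ∈ lift B ↔ v ∈ lift B := by
  by_cases hv : v = 0
  · simp [hv]
  · rw [mem_lift hv, mem_lift (smul_ne_zero hc hv)]
    have : Projectivization.mk ℝ (c • v) (smul_ne_zero hc hv) = Projectivization.mk ℝ v hv :=
      (Projectivization.mk_eq_mk_iff' ℝ _ _ _ _).2 ⟨c, rfl⟩
    rw [this]

theorem neg_mem_lift {B : Set (RP n)} {v : Fin (n + 1) → ℝ} : -v ∈ lift B ↔ v ∈ lift B := by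
  rw [← smul_mem_lift (v := v) (c := -1) (by norm_num), neg_one_smul]

theorem smul_mem_lift_smul {B : Set (RP n)} {v : Fin (n + 1) → ℝ} (g : GLin n) :
    g • v ∈ lift (g • B) ↔ v ∈ lift B := by
  by_cases hv : v = 0
  · simp only [hv, smul_zero]
    exact ⟨fun h => absurd rfl h.1, fun h => absurd rfl h.1⟩
  · rw [mem_lift hv, mem_lift ((smul_ne_zero_iff_ne g).2 hv), ← Projectivization.smul_mk,
      Set.smul_mem_smul_set_iff]

theorem lift_eq_image (B : Set (RP n)) : lift B = Subtype.val '' (proj ⁻¹' B) := by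
  ext v
  constructor
  · rintro ⟨hv, h⟩
    exact ⟨⟨v, hv⟩, h, rfl⟩
  · rintro ⟨v, h, rfl⟩
    exact ⟨v.2, h⟩

theorem isOpen_lift {B : Set (RP n)} (hB : IsOpen B) : IsOpen (lift B) := by
  rw [lift_eq_image]
  exact (isOpen_ne.isOpenMap_subtype_val) _ (hB.preimage continuous_proj)

/-- The projection and the inclusion of the nonzero vectors are both continuous and open, and
preimages under such maps commute with the frontier. -/
theorem mem_lift_frontier {B : Set (RP n)} {v : Fin (n + 1) → ℝ} (hv : v ≠ 0) :
    v ∈ lift (frontier B) ↔ v ∈ frontier (lift B) := by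
  have ho : IsOpenMap (Subtype.val : {v : Fin (n + 1) → ℝ // v ≠ 0} → Fin (n + 1) → ℝ) :=
    isOpen_ne.isOpenMap_subtype_val
  have h1 : (Subtype.val : {v : Fin (n + 1) → ℝ // v ≠ 0} → Fin (n + 1) → ℝ) ⁻¹' lift B =
      proj ⁻¹' B := by
    rw [lift_eq_image, Set.preimage_image_eq _ Subtype.val_injective]
  have h2 : (⟨v, hv⟩ : {v : Fin (n + 1) → ℝ // v ≠ 0}) ∈ proj ⁻¹' frontier B ↔
      (⟨v, hv⟩ : {v : Fin (n + 1) → ℝ // v ≠ 0}) ∈ Subtype.val ⁻¹' frontier (lift B) := by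
    rw [isOpenMap_proj.preimage_frontier_eq_frontier_preimage continuous_proj,
      ho.preimage_frontier_eq_frontier_preimage continuous_subtype_val, h1]
  rw [mem_lift hv]
  exact h2

theorem mem_lift_affineChart_image {C : Set (EuclideanSpace ℝ (Fin n))} {u : Fin (n + 1) → ℝ} :
    u ∈ lift (affineChart '' C) ↔
      ∃ c : ℝ, c ≠ 0 ∧ ∃ x ∈ C, u = c • (Fin.cons 1 (fun j => x j) : Fin (n + 1) → ℝ) := by
  constructor
  · rintro ⟨hu, x, hx, hxu⟩
    obtain ⟨c, hc⟩ := (Projectivization.mk_eq_mk_iff ℝ _ _ _ hu).1 hxu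
    refine ⟨((c⁻¹ : ℝˣ) : ℝ), (c⁻¹).ne_zero, x, hx, ?_⟩
    rw [← hc]
    exact (inv_smul_smul c u).symm
  · rintro ⟨c, hc, x, hx, rfl⟩
    exact (smul_mem_lift hc).2 ⟨cons_one_ne_zero x, x, hx, rfl⟩

/-- A convex domain of projective space is the projectivization of an open convex cone. -/
theorem IsConvexDomain.exists_cone {Ω : Set (RP n)} (h : IsConvexDomain Ω) :
    ∃ K : Set (Fin (n + 1) → ℝ), IsOpenConvexCone K ∧ ∀ v, v ∈ lift Ω ↔ v ∈ K ∨ -v ∈ K := by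
  obtain ⟨g, C, hC, hΩ⟩ := h.convex
  have hmem : ∀ v, v ∈ lift Ω ↔ ∃ c : ℝ, c ≠ 0 ∧ ∃ x ∈ C,
      v = c • g • (Fin.cons 1 (fun j => x j) : Fin (n + 1) → ℝ) := by
    intro v
    rw [hΩ, ← smul_inv_smul g v, smul_mem_lift_smul, mem_lift_affineChart_image]
    simp only [inv_smul_eq_iff, smul_comm g, smul_inv_smul]
  -- This is the form defining the hyperplane at infinity of the chart. It does not vanish on `lift
  -- Ω`, and `K` is the half where it is positive.
  let ℓ : (Fin (n + 1) → ℝ) →ₗ[ℝ] ℝ :=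
    (LinearMap.proj 0).comp (g⁻¹ : GLin n).toLinearEquiv.toLinearMap
  have hℓ : ∀ (c : ℝ) (x : EuclideanSpace ℝ (Fin n)),
      ℓ (c • g • (Fin.cons 1 (fun j => x j) : Fin (n + 1) → ℝ)) = c := by
    intro c x
    rw [map_smul]
    change c • (g⁻¹ • g • (Fin.cons 1 (fun j => x j) : Fin (n + 1) → ℝ)) 0 = c
    rw [inv_smul_smul]
    simp
  have hK : ∀ v, (v ∈ lift Ω ∧ 0 < ℓ v) ↔ ∃ c : ℝ, 0 < c ∧ ∃ x ∈ C,
      v = c • g • (Fin.cons 1 (fun j => x j) : Fin (n + 1) → ℝ) := by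
    intro v
    rw [hmem]
    constructor
    · rintro ⟨⟨c, hc, x, hx, rfl⟩, hpos⟩
      rw [hℓ] at hpos
      exact ⟨c, hpos, x, hx, rfl⟩
    · rintro ⟨c, hc, x, hx, rfl⟩
      exact ⟨⟨c, hc.ne', x, hx, rfl⟩, by rwa [hℓ]⟩
  have hne : ∀ v ∈ lift Ω, ℓ v ≠ 0 := by
    intro v hv
    obtain ⟨c, hc, x, hx, rfl⟩ := (hmem v).1 hv
    rwa [hℓ]
  refine ⟨{v | v ∈ lift Ω ∧ 0 < ℓ v}, ⟨?_, ?_, ?_, ?_, ?_⟩, ?_⟩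
  · exact (isOpen_lift h.isOpen).inter
      (isOpen_lt continuous_const ℓ.continuous_of_finiteDimensional)
  · obtain ⟨p, hp⟩ := h.nonempty
    rw [hΩ] at hp
    obtain ⟨_, ⟨x, hx, rfl⟩, -⟩ := hp
    exact ⟨_, (hK _).2 ⟨1, one_pos, x, hx, rfl⟩⟩
  · intro v w hv hw
    obtain ⟨a, ha, x, hx, rfl⟩ := (hK v).1 hv
    obtain ⟨b, hb, y, hy, rfl⟩ := (hK w).1 hw
    have hab : 0 < a + b := add_pos ha hb
    refine (hK _).2 ⟨a + b, hab, (a / (a + b)) • x + (b / (a + b)) • y,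
      hC hx hy (by positivity) (by positivity) (by field_simp), ?_⟩
    rw [smul_comm a, smul_comm b, smul_comm (a + b), ← smul_add]
    congr 1
    ext j
    refine Fin.cases ?_ (fun j => ?_) j
    · simp
    · simp
      field_simp
  · intro c v hc hv
    obtain ⟨a, ha, x, hx, rfl⟩ := (hK v).1 hv
    exact (hK _).2 ⟨c * a, mul_pos hc ha, x, hx, smul_smul _ _ _⟩
  · rintro ⟨h0, -⟩
    exact h0.1 rfl
  · intro v
    constructor
    · intro hv
      rcases lt_or_gt_of_ne (hne v hv) with h1 | h1
      · exact Or.inr ⟨neg_mem_lift.2 hv, by rw [map_neg]; linarith⟩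
      · exact Or.inl ⟨hv, h1⟩
    · rintro (hv | hv)
      · exact hv.1
      · exact neg_mem_lift.1 hv.1

variable {Ω : Set (RP n)} {K : Set (Fin (n + 1) → ℝ)}

/-- Each of `K` and `-K` misses the closure of the other, so the frontier of the union is the union
of the frontiers. -/
theorem mem_lift_frontier_iff (hK : IsOpenConvexCone K)
    (hΩ : ∀ v, v ∈ lift Ω ↔ v ∈ K ∨ -v ∈ K) {v : Fin (n + 1) → ℝ} (hv : v ≠ 0) :
    v ∈ lift (frontier Ω) ↔ v ∈ frontier K ∨ -v ∈ frontier K := by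
  have hl : lift Ω = K ∪ -K := Set.ext hΩ
  rw [mem_lift_frontier hv, hl, frontier, (hK.isOpen.union hK.isOpen.neg).interior_eq,
    closure_union, hK.frontier_eq, ← neg_closure]
  have h1 : -v ∈ K → v ∉ closure K := fun h => by simpa using hK.neg_notMem_closure h
  have h2 : v ∈ K → -v ∉ closure K := hK.neg_notMem_closure
  simp only [Set.mem_sdiff, Set.mem_union, Set.mem_neg]
  tauto

/-- The frontier of an open convex cone is not contained in a subspace of codimension two. -/
theorem exists_mem_frontier_notMem {V : Type*} [NormedAddCommGroup V] [NormedSpace ℝ V]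
    [FiniteDimensional ℝ V] {K : Set V} (hK : IsOpenConvexCone K) (P : Submodule ℝ V)
    (hP : Module.finrank ℝ P + 1 < Module.finrank ℝ V) (hPK : ∀ a ∈ K, a ∉ P) :
    ∃ w ∈ frontier K, w ∉ P := by
  by_contra! hcon
  obtain ⟨a, ha⟩ := hK.nonempty
  obtain ⟨u, hu⟩ : ∃ u, u ∉ P ⊔ Submodule.span ℝ {a} := by
    by_contra! hall
    have htop : P ⊔ Submodule.span ℝ {a} = ⊤ := Submodule.eq_top_iff'.2 hall
    have h1 := Submodule.finrank_add_le_finrank_add_finrank P (Submodule.span ℝ {a})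
    have h2 := finrank_span_le_card (R := ℝ) ({a} : Set V)
    rw [htop, finrank_top] at h1
    simp at h2
    omega
  -- As `u` is outside `P + ℝa`, the segments from `a` and from `-a` to `u` avoid `P`, hence avoid
  -- the frontier. Connectedness then puts `u`, and with it `-a`, into `K`.
  have key : ∀ b : V, b ∈ Submodule.span ℝ {a} → b ∉ P → ∀ v ∈ segment ℝ b u, v ∉ frontier K := by
    rintro b hb hbP _ ⟨s, t, hs, ht, hst, rfl⟩ hv
    have hmem := hcon _ hv
    by_cases h0 : t = 0
    · have h1 : s = 1 := by linarith
      simp only [h0, h1, one_smul, zero_smul, add_zero] at hmem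
      exact hbP hmem
    · refine hu ?_
      have h1 : t • u ∈ P ⊔ Submodule.span ℝ {a} := by
        have := Submodule.sub_mem _ (Submodule.mem_sup_left (T := Submodule.span ℝ {a}) hmem)
          (Submodule.mem_sup_right (S := P) (Submodule.smul_mem _ s hb))
        rwa [add_sub_cancel_left] at this
      exact (Submodule.smul_mem_iff _ h0).1 h1
  have haS : a ∈ Submodule.span ℝ {a} := Submodule.mem_span_singleton_self a
  have huK : u ∈ K := subset_of_disjoint_frontier (convex_segment a u).isPreconnected hK.isOpen
    ⟨a, left_mem_segment ℝ a u, ha⟩ (key a haS (hPK a ha)) (right_mem_segment ℝ a u)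
  have hnaK : -a ∈ K := subset_of_disjoint_frontier (convex_segment (-a) u).isPreconnected
    hK.isOpen ⟨u, right_mem_segment ℝ (-a) u, huK⟩
    (key (-a) (Submodule.neg_mem _ haS) (by simpa using hPK a ha)) (left_mem_segment ℝ (-a) u)
  exact hK.zero_notMem (by simpa using hK.add_mem ha hnaK)

theorem add_smul_mem_of_line {V : Type*} [NormedAddCommGroup V] [NormedSpace ℝ V] {K : Set V}
    (hK : IsOpenConvexCone K) {v a : V} (h1 : v ∈ closure K) (h2 : -v ∈ closure K) (ha : a ∈ K)
    (t : ℝ) : a + t • v ∈ K := by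
  rcases lt_trichotomy t 0 with ht | rfl | ht
  · have := hK.add_mem_of_mem_closure ha (hK.smul_mem_closure (neg_pos.2 ht) h2)
    simpa using this
  · simpa using ha
  · exact hK.add_mem_of_mem_closure ha (hK.smul_mem_closure ht h1)

/-- A line in the closure, translated by a point of `K`, is a line inside `K`, hence a nonconstant
projective map into `Ω`. -/
theorem isSalient_of_isProperlyConvex (hK : IsOpenConvexCone K)
    (hΩ : ∀ v, v ∈ lift Ω ↔ v ∈ K ∨ -v ∈ K) (hp : IsProperlyConvex Ω) : IsSalient K := by
  intro v h1 h2
  by_contra hv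
  obtain ⟨a, ha⟩ := hK.nonempty
  refine hp.2 ⟨a, v, ?_, fun t => (hΩ _).2 (Or.inl (add_smul_mem_of_line hK h1 h2 ha t))⟩
  rw [LinearIndependent.pair_iff]
  intro s t hst
  have hs : s = 0 := by
    by_contra hs
    refine hK.zero_notMem ?_
    have := add_smul_mem_of_line hK h1 h2 ha (s⁻¹ * t)
    have e : a + (s⁻¹ * t) • v = s⁻¹ • (s • a + t • v) := by
      rw [smul_add, smul_smul, smul_smul, inv_mul_cancel₀ hs, one_smul]
    rwa [e, hst, smul_zero] at this
  subst hs
  simpa [hv] using hst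

/-- A line `ℝv` in the closure makes the frontier invariant under translation by `ℝv`, so any
frontier point off that line lies on a boundary segment. Such a point exists because the line has
codimension `n ≥ 2`; for `n = 1` a half-plane is a counterexample. -/
theorem isSalient_of_isStrictlyConvex (hK : IsOpenConvexCone K)
    (hΩ : ∀ v, v ∈ lift Ω ↔ v ∈ K ∨ -v ∈ K) (hs : IsStrictlyConvex Ω) (hn : 2 ≤ n) :
    IsSalient K := by
  intro v h1 h2
  by_contra hv
  obtain ⟨w, hw, hwP⟩ := exists_mem_frontier_notMem hK (Submodule.span ℝ {v}) (by
      rw [finrank_span_singleton hv, Module.finrank_fin_fun]; omega) (by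
      intro a ha haP
      obtain ⟨t, rfl⟩ := Submodule.mem_span_singleton.1 haP
      refine hK.zero_notMem ?_
      have := add_smul_mem_of_line hK h1 h2 ha (-t)
      simpa using this)
  have hline : ∀ t : ℝ, w + t • v ∈ frontier K := by
    intro t
    rw [hK.frontier_eq] at hw ⊢
    refine ⟨?_, fun hmem => hw.2 ?_⟩
    · have hc : Continuous fun a : Fin (n + 1) → ℝ => a + t • v := by fun_prop
      exact map_mem_closure (f := fun a => a + t • v) hc hw.1 fun a ha => add_smul_mem_of_line hK h1 h2 ha t
    · have := add_smul_mem_of_line hK h1 h2 hmem (-t)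
      simpa using this
  refine hs.2 ⟨w, w + v, ?_, ?_⟩
  · rw [LinearIndependent.pair_iff]
    intro s t hst
    have h3 : (s + t) • w = -(t • v) := by
      rw [← sub_eq_zero, ← hst]; module
    have h4 : s + t = 0 := by
      by_contra h4
      refine hwP ((Submodule.smul_mem_iff _ h4).1 ?_)
      rw [h3]
      exact Submodule.neg_mem _ (Submodule.smul_mem _ _ (Submodule.mem_span_singleton_self v))
    rw [h4, zero_smul, zero_eq_neg] at h3
    have ht := (smul_eq_zero.1 h3).resolve_right hv
    exact ⟨by linarith, ht⟩
  · rintro _ ⟨s, t, -, -, hst, rfl⟩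
    have e : s • w + t • (w + v) = w + t • v := by
      have : s = 1 - t := by linarith
      rw [this]; module
    rw [e]
    refine (mem_lift_frontier_iff hK hΩ fun h0 => hwP ?_).2 (Or.inl (hline t))
    rw [eq_neg_of_add_eq_zero_left h0]
    exact Submodule.neg_mem _ (Submodule.smul_mem _ _ (Submodule.mem_span_singleton_self v))

/-- The image of `K` is connected and lies in the union of the disjoint open sets `K` and `-K`, so a
single point decides which. -/
theorem map_mem_of_preserves {V : Type*} [NormedAddCommGroup V] [NormedSpace ℝ V]
    [FiniteDimensional ℝ V] {K : Set V} (hK : IsOpenConvexCone K) (γ : V ≃ₗ[ℝ] V)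
    (hγ : ∀ v, v ∈ K → γ v ∈ K ∨ -γ v ∈ K) {k : V} (hk : k ∈ K) (hγk : γ k ∈ K) {v : V}
    (hv : v ∈ K) : γ v ∈ K := by
  have hpre : IsPreconnected (γ '' K) := hK.convex.isPreconnected.image _
    γ.toLinearMap.continuous_of_finiteDimensional.continuousOn
  refine hpre.subset_left_of_subset_union hK.isOpen hK.isOpen.neg ?_ ?_
    ⟨γ k, Set.mem_image_of_mem γ hk, hγk⟩ (Set.mem_image_of_mem γ hv)
  · rw [Set.disjoint_left]
    exact fun x hx hx' => hK.neg_notMem_closure hx (subset_closure hx')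
  · rintro _ ⟨x, hx, rfl⟩
    exact hγ x hx

/-- Quasi-homogeneity of a domain, in terms of its cone. -/
theorem IsQuasiHomogeneous.exists_compact (hK : IsOpenConvexCone K)
    (hΩ : ∀ v, v ∈ lift Ω ↔ v ∈ K ∨ -v ∈ K) (hq : IsQuasiHomogeneous Ω) :
    ∃ K₀ : Set (Fin (n + 1) → ℝ), IsCompact K₀ ∧ K₀ ⊆ K ∧ ∀ x ∈ K,
      ∃ γ : (Fin (n + 1) → ℝ) ≃ₗ[ℝ] (Fin (n + 1) → ℝ), (∀ v, γ v ∈ K ↔ v ∈ K) ∧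
        ∃ k ∈ K₀, γ k = x := by
  obtain ⟨G, hG, Q, hQ, hQΩ, hGQ⟩ := hq
  have hne : ∀ v ∈ K, v ≠ 0 := fun v hv h => hK.zero_notMem (h ▸ hv)
  obtain ⟨K₀, hK₀, hK₀K, hcov⟩ : ∃ K₀ : Set (Fin (n + 1) → ℝ), IsCompact K₀ ∧ K₀ ⊆ K ∧
      ∀ p ∈ Q, ∃ k ∈ K₀, ∃ hk : k ≠ 0, Projectivization.mk ℝ k hk = p := by
    -- Compactness reduces the lifting of `Q` to a neighbourhood of each point, where openness of
    -- the projection lets a compact neighbourhood in `K` do the job.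
    refine hQ.induction_on (p := fun s => ∃ K₀ : Set (Fin (n + 1) → ℝ), IsCompact K₀ ∧ K₀ ⊆ K ∧
      ∀ p ∈ s, ∃ k ∈ K₀, ∃ hk : k ≠ 0, Projectivization.mk ℝ k hk = p) ?_ ?_ ?_ ?_
    · exact ⟨∅, isCompact_empty, Set.empty_subset _, by simp⟩
    · rintro s t hst ⟨K₀, h1, h2, h3⟩
      exact ⟨K₀, h1, h2, fun p hp => h3 p (hst hp)⟩
    · rintro s t ⟨K₀, h1, h2, h3⟩ ⟨K₁, h4, h5, h6⟩
      refine ⟨K₀ ∪ K₁, h1.union h4, Set.union_subset h2 h5, ?_⟩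
      rintro p (hp | hp)
      · obtain ⟨k, hk, h⟩ := h3 p hp
        exact ⟨k, Or.inl hk, h⟩
      · obtain ⟨k, hk, h⟩ := h6 p hp
        exact ⟨k, Or.inr hk, h⟩
    · intro p hp
      obtain ⟨v, hv, rfl⟩ : ∃ v, ∃ hv : v ∈ K, Projectivization.mk ℝ v (hne v hv) = p := by
        induction p using Projectivization.ind with
        | h v hv0 =>
          rcases (hΩ v).1 ((mem_lift hv0).2 (hQΩ hp)) with h | h
          · exact ⟨v, h, rfl⟩
          · exact ⟨-v, h, (Projectivization.mk_eq_mk_iff' ℝ _ _ _ _).2 ⟨-1, by simp⟩⟩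
      obtain ⟨K₀, hK₀, hvK₀, hK₀K⟩ := exists_compact_subset hK.isOpen hv
      refine ⟨proj '' (Subtype.val ⁻¹' interior K₀), mem_nhdsWithin_of_mem_nhds ?_, K₀, hK₀,
        hK₀K, ?_⟩
      · exact (isOpenMap_proj _ (isOpen_interior.preimage continuous_subtype_val)).mem_nhds
          ⟨⟨v, hne v hv⟩, hvK₀, rfl⟩
      · rintro _ ⟨w, hw, rfl⟩
        exact ⟨w.1, interior_subset hw, w.2, rfl⟩
  refine ⟨K₀, hK₀, hK₀K, fun x hx => ?_⟩
  have hxΩ : Projectivization.mk ℝ x (hne x hx) ∈ Ω := (mem_lift _).1 ((hΩ x).2 (Or.inl hx))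
  rw [← hGQ] at hxΩ
  obtain ⟨g, hg, p, hp, hpx⟩ := Set.mem_iUnion₂.1 hxΩ
  obtain ⟨k, hk, hk0, rfl⟩ := hcov p hp
  have hpx : g • Projectivization.mk ℝ k hk0 = Projectivization.mk ℝ x (hne x hx) := hpx
  rw [Projectivization.smul_mk] at hpx
  obtain ⟨c, hc⟩ := (Projectivization.mk_eq_mk_iff ℝ _ _ _ _).1 hpx.symm
  -- The scalar `c` makes `γ k` equal to `x` itself rather than to a multiple of it; as `k` and `x`
  -- lie in `K`, this also fixes the sign of `γ`.
  let γ : (Fin (n + 1) → ℝ) ≃ₗ[ℝ] (Fin (n + 1) → ℝ) :=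
    g.toLinearEquiv.trans (LinearEquiv.smulOfUnit c)
  have hγ : ∀ v, γ v = (c : ℝ) • g • v := fun v => rfl
  have hγk : γ k = x := hc
  have hstab : g • Ω = Ω := hG hg
  have hpres : ∀ v, (γ v ∈ K ∨ -γ v ∈ K) ↔ (v ∈ K ∨ -v ∈ K) := by
    intro v
    rw [← hΩ, ← hΩ, hγ, smul_mem_lift c.ne_zero]
    conv_lhs => rw [← hstab]
    exact smul_mem_lift_smul g
  refine ⟨γ, fun v => ⟨fun h => ?_, fun h => ?_⟩, k, hk, hγk⟩
  · have := map_mem_of_preserves hK γ.symm (fun w hw => (hpres _).1 (by simpa using Or.inl hw))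
      (k := γ k) (by rwa [hγk]) (by simpa using hK₀K hk) h
    simpa using this
  · exact map_mem_of_preserves hK γ (fun w hw => (hpres w).2 (Or.inl hw)) (hK₀K hk)
      (by rwa [hγk]) h

/-- A domain whose cone is the cone over a ball is projectively equivalent to a ball. -/
theorem isProjectivelyEquivalentToBall_of_linearEquiv
    (hΩ : ∀ v, v ∈ lift Ω ↔ v ∈ K ∨ -v ∈ K)
    (S : (ℝ × EuclideanSpace ℝ (Fin n)) ≃ₗ[ℝ] (Fin (n + 1) → ℝ))
    (hS : ∀ z, S z ∈ K ↔ z ∈ ballCone _) : IsProjectivelyEquivalentToBall Ω := by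
  let κ : (Fin (n + 1) → ℝ) ≃ₗ[ℝ] (ℝ × EuclideanSpace ℝ (Fin n)) :=
    { toFun := fun v => (v 0, WithLp.toLp 2 fun j => v j.succ)
      map_add' := fun _ _ => rfl
      map_smul' := fun _ _ => rfl
      invFun := fun z => Fin.cons z.1 fun j => z.2 j
      left_inv := fun v => Fin.cons_self_tail v
      right_inv := fun z => rfl }
  let g : GLin n := LinearMap.GeneralLinearGroup.ofLinearEquiv (κ.trans S)
  have hg : ∀ u, g • u = S (κ u) := fun u => rfl
  have hcone : ∀ u, κ u ∈ ballCone (EuclideanSpace ℝ (Fin n)) ↔ ∃ c : ℝ, 0 < c ∧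
      ∃ x ∈ Metric.ball (0 : EuclideanSpace ℝ (Fin n)) 1,
        u = c • (Fin.cons 1 (fun j => x j) : Fin (n + 1) → ℝ) := by
    intro u
    constructor
    · intro h
      have h1 : ‖(κ u).2‖ < (κ u).1 := h
      have h2 : 0 < (κ u).1 := (norm_nonneg _).trans_lt h1
      refine ⟨(κ u).1, h2, (κ u).1⁻¹ • (κ u).2, ?_, κ.injective ?_⟩
      · rw [mem_ball_zero_iff, norm_smul, norm_inv, Real.norm_eq_abs, abs_of_pos h2,
          inv_mul_lt_iff₀ h2, mul_one]
        exact h1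
      · rw [map_smul]
        change κ u = (κ u).1 • (1, (κ u).1⁻¹ • (κ u).2)
        rw [Prod.smul_mk, smul_smul, mul_inv_cancel₀ h2.ne', one_smul, smul_eq_mul, mul_one]
    · rintro ⟨c, hc, x, hx, rfl⟩
      rw [map_smul]
      refine isOpenConvexCone_ballCone.smul_mem hc ?_
      rw [mem_ball_zero_iff] at hx
      exact hx
  have hlift : ∀ u, u ∈ lift (affineChart '' Metric.ball (0 : EuclideanSpace ℝ (Fin n)) 1) ↔
      g • u ∈ lift Ω := by
    intro u
    rw [hΩ, hg, ← map_neg, ← map_neg, hS, hS, hcone, hcone, mem_lift_affineChart_image]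
    constructor
    · rintro ⟨c, hc, x, hx, rfl⟩
      rcases lt_or_gt_of_ne hc with h | h
      · exact Or.inr ⟨-c, by linarith, x, hx, (neg_smul _ _).symm⟩
      · exact Or.inl ⟨c, h, x, hx, rfl⟩
    · rintro (⟨c, hc, x, hx, h⟩ | ⟨c, hc, x, hx, h⟩)
      · exact ⟨c, hc.ne', x, hx, h⟩
      · exact ⟨-c, (neg_neg_of_pos hc).ne, x, hx, by
          rw [neg_smul, ← h, neg_neg]⟩
  refine ⟨g, ?_⟩
  ext p
  induction p using Projectivization.ind with
  | h v hv =>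
    rw [← mem_lift hv, ← mem_lift hv, ← smul_inv_smul g v, ← hlift, smul_mem_lift_smul]

end Projective

/-! ### Affine slices and graph coordinates. -/

/-- The frontier of an affine slice of an open convex cone. -/
theorem mem_frontier_slice {F : Type*} [NormedAddCommGroup F] [NormedSpace ℝ F]
    {K : Set (ℝ × F)} (hK : IsOpenConvexCone K) {w : F} :
    w ∈ frontier {w : F | ((1 : ℝ), w) ∈ K} ↔ ((1 : ℝ), w) ∈ frontier K := by
  have hc : Continuous fun w : F => ((1 : ℝ), w) := by fun_prop
  have ho : IsOpen {w : F | ((1 : ℝ), w) ∈ K} := hK.isOpen.preimage hc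
  rw [hK.frontier_eq, frontier, ho.interior_eq]
  refine and_congr ⟨fun h => map_mem_closure hc h fun _ => id, fun h => ?_⟩ Iff.rfl
  -- Central projection onto the slice is continuous near `(1, w)` and carries nearby points of `K`
  -- into the slice.
  have hφ : Tendsto (fun z : ℝ × F => z.1⁻¹ • z.2) (𝓝 (1, w)) (𝓝 w) := by
    have : ContinuousAt (fun z : ℝ × F => z.1⁻¹ • z.2) (1, w) :=
      (continuousAt_fst.inv₀ one_ne_zero).smul continuousAt_snd
    simpa [ContinuousAt] using this
  have hpos : ∀ᶠ z : ℝ × F in 𝓝 (1, w), 0 < z.1 :=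
    continuousAt_fst.eventually (lt_mem_nhds one_pos)
  refine mem_closure_iff_frequently.2 (hφ.frequently ?_)
  refine ((mem_closure_iff_frequently.1 h).and_eventually hpos).mono fun z hz => ?_
  have h1 := hK.smul_mem (inv_pos.2 hz.2) hz.1
  have h2 : z.1⁻¹ • z = (1, z.1⁻¹ • z.2) := by
    refine Prod.ext ?_ rfl
    simp [hz.2.ne']
  rwa [h2] at h1

section Coordinates

variable {n : ℕ}

/-- Insert the coordinate `s` in position `i`. -/
def insertCoord (i : Fin n) (y : EuclideanSpace ℝ {j : Fin n // j ≠ i}) (s : ℝ) :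
    EuclideanSpace ℝ (Fin n) :=
  WithLp.toLp 2 fun j => if h : j = i then s else y ⟨j, h⟩

theorem dropCoord_insertCoord (i : Fin n) (y : EuclideanSpace ℝ {j : Fin n // j ≠ i}) (s : ℝ) :
    dropCoord i (insertCoord i y s) = y := by
  ext j
  simp [dropCoord, insertCoord, j.2]

theorem insertCoord_apply_self (i : Fin n) (y : EuclideanSpace ℝ {j : Fin n // j ≠ i}) (s : ℝ) :
    insertCoord i y s i = s := by
  simp [insertCoord]

theorem insertCoord_dropCoord (i : Fin n) (x : EuclideanSpace ℝ (Fin n)) :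
    insertCoord i (dropCoord i x) (x i) = x := by
  ext j
  by_cases h : j = i
  · subst h; simp [insertCoord]
  · simp [insertCoord, dropCoord, h]

theorem continuous_insertCoord (i : Fin n) :
    Continuous fun w : EuclideanSpace ℝ {j : Fin n // j ≠ i} × ℝ => insertCoord i w.1 w.2 := by
  refine (PiLp.continuous_toLp 2 _).comp (continuous_pi fun j => ?_)
  by_cases h : j = i
  · simpa [h] using continuous_snd
  · simp only [h, dite_false]
    fun_prop

/-- The linear coordinates on `ℝ^(n+1)` singling out the coordinates `0` and `i + 1`. -/
def splitCoord (i : Fin n) :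
    (ℝ × EuclideanSpace ℝ {j : Fin n // j ≠ i} × ℝ) ≃ₗ[ℝ] (Fin (n + 1) → ℝ) where
  toFun z := Fin.cons z.1 fun j => insertCoord i z.2.1 z.2.2 j
  map_add' x y := by
    ext j
    refine Fin.cases rfl (fun j => ?_) j
    by_cases h : j = i <;> simp [insertCoord, h]
  map_smul' c x := by
    ext j
    refine Fin.cases rfl (fun j => ?_) j
    by_cases h : j = i <;> simp [insertCoord, h]
  invFun v := (v 0, WithLp.toLp 2 fun j => v j.1.succ, v i.succ)
  left_inv z := by
    refine Prod.ext rfl (Prod.ext ?_ ?_)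
    · ext j
      simp [insertCoord, j.2]
    · simp [insertCoord]
  right_inv v := by
    ext j
    refine Fin.cases rfl (fun j => ?_) j
    by_cases h : j = i <;> simp [insertCoord, h]

end Coordinates

/-! ### Conclusion. -/

/-- A strictly convex quasi-homogeneous domain with salient cone is a ball, if its frontier is
twice differentiable near some point. -/
theorem isProjectivelyEquivalentToBall_of_isSalient {n : ℕ} {Ω : Set (RP n)}
    {K : Set (Fin (n + 1) → ℝ)} (hK : IsOpenConvexCone K)
    (hΩ : ∀ v, v ∈ lift Ω ↔ v ∈ K ∨ -v ∈ K) (hKs : IsSalient K) (hstrict : IsStrictlyConvex Ω)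
    (hqh : IsQuasiHomogeneous Ω) {p : RP n} (hp : p ∈ frontier Ω)
    (hd : BoundaryTwiceDifferentiableNear Ω p) : IsProjectivelyEquivalentToBall Ω := by
  obtain ⟨g, i, W, U, f, hW, hU, hf, ⟨x₀, hx₀, rfl⟩, hfr⟩ := hd
  obtain ⟨K₀, hK₀, hK₀K, hγ⟩ := hqh.exists_compact hK hΩ
  have hseg : ¬ ∃ a b : Fin (n + 1) → ℝ, LinearIndependent ℝ ![a, b] ∧
      ∀ v ∈ segment ℝ a b, v ∈ frontier K := by
    rintro ⟨a, b, hab, h⟩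
    refine hstrict.2 ⟨a, b, hab, fun v hv => ?_⟩
    refine (mem_lift_frontier_iff hK hΩ ?_).2 (Or.inl (h v hv))
    rintro rfl
    obtain ⟨s, t, -, -, hst, h0⟩ := hv
    obtain ⟨rfl, rfl⟩ := LinearIndependent.pair_iff.1 hab s t h0
    simp at hst
  set y₀ := dropCoord i x₀ with hy₀
  have hs₀ : x₀ i = f y₀ := ((hfr x₀ hx₀).2).1 hp
  have hx₀' : insertCoord i y₀ (f y₀) = x₀ := by rw [← hs₀, hy₀, insertCoord_dropCoord]
  let Θ₀ := (splitCoord i).trans g.toLinearEquiv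
  have hΘ₀ : ∀ y s, g • affineChart (insertCoord i y s) ∈ frontier Ω ↔
      Θ₀ (1, y, s) ∈ frontier K ∨ -Θ₀ (1, y, s) ∈ frontier K := by
    intro y s
    have h0 : Θ₀ (1, y, s) ≠ 0 := fun h => by
      rw [map_eq_zero_iff _ Θ₀.injective] at h
      simpa using congrArg Prod.fst h
    rw [← mem_lift_frontier_iff hK hΩ h0, mem_lift h0]
    rfl
  -- The chart may represent the base point by a frontier vector of `-K`; a change of sign moves it
  -- to `K`.
  obtain ⟨Θ₁, hΘ₁, hΘ₁₀⟩ : ∃ Θ₁ : (ℝ × EuclideanSpace ℝ {j : Fin n // j ≠ i} × ℝ) ≃ₗ[ℝ]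
      (Fin (n + 1) → ℝ), (∀ y s, g • affineChart (insertCoord i y s) ∈ frontier Ω ↔
        Θ₁ (1, y, s) ∈ frontier K ∨ -Θ₁ (1, y, s) ∈ frontier K) ∧
        Θ₁ (1, y₀, f y₀) ∈ frontier K := by
    rw [← hx₀'] at hp
    rcases (hΘ₀ _ _).1 hp with h | h
    · exact ⟨Θ₀, hΘ₀, h⟩
    · refine ⟨Θ₀.trans (LinearEquiv.neg ℝ), fun y s => ?_, h⟩
      rw [hΘ₀, or_comm]
      simp
  have hcΘ : Continuous fun w : EuclideanSpace ℝ {j : Fin n // j ≠ i} × ℝ => Θ₁ (1, w.1, w.2) :=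
    Θ₁.toLinearMap.continuous_of_finiteDimensional.comp (by fun_prop)
  have hK₁ := hK.preimage Θ₁
  have hfront : ∀ w : EuclideanSpace ℝ {j : Fin n // j ≠ i} × ℝ,
      w ∈ frontier {w : EuclideanSpace ℝ {j : Fin n // j ≠ i} × ℝ | ((1 : ℝ), w) ∈ Θ₁ ⁻¹' K} ↔
        Θ₁ (1, w.1, w.2) ∈ frontier K := by
    intro w
    have h : frontier (Θ₁ ⁻¹' K) = Θ₁ ⁻¹' frontier K :=
      (Θ₁.toContinuousLinearEquiv.toHomeomorph.preimage_frontier K).symm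
    rw [mem_frontier_slice hK₁, h]
    rfl
  -- By salience only the branch `K`, not `-K`, is visible near the base point.
  have hnotneg : -Θ₁ (1, y₀, f y₀) ∉ closure K := by
    intro h
    rw [hK.frontier_eq] at hΘ₁₀
    have h0 := hKs _ hΘ₁₀.1 h
    rw [map_eq_zero_iff _ Θ₁.injective] at h0
    simpa using congrArg Prod.fst h0
  have hevW : ∀ᶠ w : EuclideanSpace ℝ {j : Fin n // j ≠ i} × ℝ in 𝓝 (y₀, f y₀),
      insertCoord i w.1 w.2 ∈ W :=
    (continuous_insertCoord i).continuousAt.eventually (hW.mem_nhds (show insertCoord i y₀ (f y₀) ∈ W by rwa [hx₀']))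
  have hevN : ∀ᶠ w : EuclideanSpace ℝ {j : Fin n // j ≠ i} × ℝ in 𝓝 (y₀, f y₀),
      -Θ₁ (1, w.1, w.2) ∉ closure K :=
    (hcΘ.neg.tendsto (y₀, f y₀)).eventually (isClosed_closure.isOpen_compl.mem_nhds hnotneg)
  have hy₀U : y₀ ∈ U := (hfr x₀ hx₀).1
  obtain ⟨ε, hε, r₁, hr₁, δ, hδ, hfδ, hside⟩ := exists_side_of_frontier_graph
    (D := {w : EuclideanSpace ℝ {j : Fin n // j ≠ i} × ℝ | ((1 : ℝ), w) ∈ Θ₁ ⁻¹' K})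
    (f := f) (y₀ := y₀)
    (hK₁.isOpen.preimage (by fun_prop))
    (by
      intro a ha b hb u v hu hv huv
      have := hK₁.convex ha hb hu hv huv
      have e : u • ((1 : ℝ), a) + v • ((1 : ℝ), b) = (1, u • a + v • b) :=
        Prod.ext (by simp [huv]) rfl
      rwa [e] at this)
    (hf.1.differentiableAt (hU.mem_nhds hy₀U)).continuousAt
    (frontier_subset_closure ((hfront _).2 hΘ₁₀))
    (by
      filter_upwards [hevW, hevN] with w hw1 hw2
      have h1 := (hfr _ hw1).2
      rw [dropCoord_insertCoord, insertCoord_apply_self, hΘ₁] at h1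
      rw [hfront, ← h1]
      exact ⟨Or.inl, fun h => h.resolve_right fun h' => hw2 (frontier_subset_closure h')⟩)
  obtain ⟨r₂, hr₂, hr₂U⟩ := Metric.isOpen_iff.1 hU y₀ hy₀U
  have hεε : ε * ε = 1 := by rcases hε with rfl | rfl <;> norm_num
  have habs : |ε| = 1 := by rcases hε with rfl | rfl <;> norm_num
  have hε0 : ε ≠ 0 := by rintro rfl; simp at hεε
  have hbox : ∀ s, |s - ε * f y₀| = |ε * s - f y₀| := fun s => by
    have : s - ε * f y₀ = ε * (ε * s - f y₀) := by linear_combination (-s) * hεε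
    rw [this, abs_mul, habs, one_mul]
  have hb1 : Metric.ball y₀ (min r₁ r₂) ⊆ Metric.ball y₀ r₁ :=
    Metric.ball_subset_ball (min_le_left _ _)
  have hb2 : Metric.ball y₀ (min r₁ r₂) ⊆ U :=
    (Metric.ball_subset_ball (min_le_right _ _)).trans hr₂U
  -- If the cone lies below the graph (`ε = -1`), flipping the last coordinate puts it above the
  -- graph of `ε * f`.
  let R : (ℝ × EuclideanSpace ℝ {j : Fin n // j ≠ i} × ℝ) ≃ₗ[ℝ]
      (ℝ × EuclideanSpace ℝ {j : Fin n // j ≠ i} × ℝ) :=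
    (LinearEquiv.refl ℝ ℝ).prodCongr ((LinearEquiv.refl ℝ _).prodCongr
      (LinearEquiv.smulOfNeZero ℝ ℝ ε hε0))
  have hR : ∀ a y s, R (a, y, s) = (a, y, ε * s) := fun a y s => rfl
  have hcard : Module.finrank ℝ (EuclideanSpace ℝ {j : Fin n // j ≠ i}) + 1 = n := by
    rw [finrank_euclideanSpace, Fintype.card_subtype_compl, Fintype.card_fin,
      Fintype.card_subtype_eq]
    have := i.pos
    omega
  obtain ⟨S, hS⟩ := exists_linearEquiv_ballCone_of_graph hK hKs hseg hK₀ hK₀K hγ (R.trans Θ₁)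
    (f := fun y => ε * f y) (y₀ := y₀) (s₀ := ε * f y₀) (δ := δ) (lt_min hr₁ hr₂)
    ⟨(hf.1.mono hb2).const_mul ε, by
      have h1 : fderiv ℝ (fun y => ε * f y) = fun y => ε • fderiv ℝ f y := by
        exact fderiv_const_smul_field (f := f) ε
      rw [h1]
      exact (hf.2.mono hb2).const_smul ε⟩
    (fun y hy => by
      rw [hbox, ← mul_assoc, hεε, one_mul]
      exact hfδ y (hb1 hy))
    (fun y hy s hs => by
      rw [hbox] at hs
      have := hside y (hb1 hy) (ε * s) hs
      rw [← mul_assoc, hεε, one_mul] at this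
      rw [LinearEquiv.trans_apply, hR]
      exact this) hcard
  exact isProjectivelyEquivalentToBall_of_linearEquiv hΩ S hS

theorem isProjectivelyEquivalentToBall_zero {Ω : Set (RP 0)} (h : Ω.Nonempty) :
    IsProjectivelyEquivalentToBall Ω := by
  have hsub : Subsingleton (RP 0) := ⟨fun p q => by
    have hfin : ∀ j : Fin (0 + 1), j = 0 := fun j => Fin.fin_one_eq_zero j
    induction p using Projectivization.ind with
    | h v hv =>
      induction q using Projectivization.ind with
      | h w hw =>
        refine (Projectivization.mk_eq_mk_iff' ℝ _ _ _ _).2 ⟨v 0 / w 0, ?_⟩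
        have hw0 : w 0 ≠ 0 := fun h0 => hw (funext fun j => by rw [hfin j, h0]; rfl)
        ext j
        rw [hfin j]
        simp [hw0]⟩
  refine ⟨1, ?_⟩
  rw [one_smul]
  exact (Subsingleton.eq_univ_of_nonempty h).trans (Subsingleton.eq_univ_of_nonempty
    ((Metric.nonempty_ball.2 one_pos).image _)).symm

end QuasiHom

theorem theorem5p1 (n : ℕ) (Ω : Set (QuasiHom.RP n))
    (hstrict : QuasiHom.IsStrictlyConvex Ω)
    (hproper : n = 1 → QuasiHom.IsProperlyConvex Ω)
    (hqh : QuasiHom.IsQuasiHomogeneous Ω) :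
    ((∀ p ∈ frontier Ω, QuasiHom.BoundaryTwiceDifferentiableNear Ω p) →
      QuasiHom.IsProjectivelyEquivalentToBall Ω) ∧
    ((∃ O : Set (QuasiHom.RP n), IsOpen O ∧ (O ∩ frontier Ω).Nonempty ∧
        ∀ p ∈ O ∩ frontier Ω, QuasiHom.BoundaryTwiceDifferentiableNear Ω p) →
      QuasiHom.IsProjectivelyEquivalentToBall Ω) := by
  open QuasiHom in
  obtain rfl | hn := Nat.eq_zero_or_pos n
  · have := isProjectivelyEquivalentToBall_zero hstrict.1.nonempty
    exact ⟨fun _ => this, fun _ => this⟩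
  obtain ⟨K, hK, hΩ⟩ := hstrict.1.exists_cone
  have hKs : IsSalient K := by
    rcases Nat.lt_or_ge 1 n with h | h
    · exact isSalient_of_isStrictlyConvex hK hΩ hstrict h
    · exact isSalient_of_isProperlyConvex hK hΩ (hproper (by omega))
  refine ⟨fun h => ?_, ?_⟩
  -- Some boundary point must exist: as `n ≥ 1`, the zero subspace has codimension at least two, so
  -- the frontier of `K` has a nonzero vector.
  · have hnotmem : ∀ a ∈ K, a ∉ (⊥ : Submodule ℝ (Fin (n + 1) → ℝ)) := by
      intro a ha h0
      rw [Submodule.mem_bot] at h0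
      exact hK.zero_notMem (h0 ▸ ha)
    obtain ⟨w, hw, hw0⟩ := exists_mem_frontier_notMem hK ⊥
      (by rw [finrank_bot, Module.finrank_fin_fun]; omega) hnotmem
    rw [Submodule.mem_bot] at hw0
    have hp := (mem_lift hw0).1 ((mem_lift_frontier_iff hK hΩ hw0).2 (Or.inl hw))
    exact isProjectivelyEquivalentToBall_of_isSalient hK hΩ hKs hstrict hqh hp (h _ hp)
  · rintro ⟨O, -, ⟨p, hp⟩, h⟩
    exact isProjectivelyEquivalentToBall_of_isSalient hK hΩ hKs hstrict hqh hp.2 (h p hp)
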